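/- Let $\mathbb{N}=\{1,2,\dots\}$, let $\mathbb{N}_2$ be the set of unordered pairs of distinct elements of $\mathbb{N}$, and let $\mu$ be a probability measure on $\mathbb{N}_2$, $\mu_{ij}:=\mu(\{\{i,j\}\})$. Assume that $\mu$ has unbounded support, i.e. the set of $v\in\mathbb{N}$ that belong to some $e\in\mathbb{N}_2$ with $\mu(\{e\})>0$ is unbounded. Discrete time: let $e_1,e_2,\dots$ be i.i.d. with law $\mu$, let $G_0$ be the empty graph, and $G_{n+1}:=G_n\cup e_{n+1}$ (add the edge $e_{n+1}$ together with its two endpoints). Continuous time: let $(N_e(t))_{t\ge 0}$, $e\in\mathbb{N}_2$, be independent Poisson processes with intensities $\mu(\{e\})$, and let $G_t$ be the graph whose edges are the $e$ with $N_e(t)>0$ and whose vertices are the endpoints of these edges. Parallel edges are identified in both models. A graph $G=(V,E)$ is essentially complete if it is connected and there is an $n\in\mathbb{N}$ such that $V=\{1,\dots,n,n+1\}$ and the subgraph induced on $\{1,\dots,n\}$ is complete. A process $X$ indexed by $I$ has a property eventually forever (for a given outcome) if there is $i\in I$ such that $X(j)$ has the property for all $j\in I$ with $j>i$. For $n\in\mathbb{N}$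 put $$\Lambda_n:=\sum_{\{i,j\}\in\mathbb{N}_2:\ \max(i,j)>n}\mu_{ij},\qquad p_n:=\int_0^\infty\ \prod_{\{i,j\}\in\mathbb{N}_2:\ \max(i,j)=n}\left(1-e^{-\mu_{ij}t}\right)\Lambda_n e^{-\Lambda_n t}\,dt ,$$ where an empty product equals $1$. Then the limit $L:=\lim_{N\to\infty}\prod_{n=1}^N p_n$ exists. If $L>0$, then $G_t$ and $G_n$ are almost surely eventually forever essentially complete. Otherwise, $G_t$ and $G_n$ are almost surely not eventually forever essentially complete. -/

import Mathlib

open MeasureTheory ProbabilityTheory Filter Topology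
open scoped NNReal

namespace EdgeProcess

/-- The possible edges: unordered pairs of distinct positive integers. -/
@[ext]
structure Edge where
  /-- The underlying unordered pair. -/
  toSym2 : Sym2 ℕ+
  not_isDiag : ¬ toSym2.IsDiag

/-- The countable set of edges carries the discrete σ-algebra. -/
instance : MeasurableSpace Edge := ⊤

namespace Edge

/-- The larger endpoint `max(i,j)` of the edge `{i,j}`. -/
def max (e : Edge) : ℕ+ := e.toSym2.sup

/-- The edge `{i,n}`, for `i < n`. -/
def mk' (i n : ℕ+) (h : i < n) : Edge := ⟨s(i, n), by simpa using h.ne⟩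

theorem max_mk' (i n : ℕ+) (h : i < n) : (mk' i n h).max = n :=
  sup_eq_right.2 h.le

theorem exists_eq_mk' (e : Edge) : ∃ (i n : ℕ+) (h : i < n), e = mk' i n h := by
  obtain ⟨e, he⟩ := e
  induction e with
  | _ a b =>
    have hab : a ≠ b := by simpa using he
    rcases lt_or_gt_of_ne hab with h | h
    · exact ⟨a, b, h, rfl⟩
    · exact ⟨b, a, h, Edge.ext Sym2.eq_swap⟩

theorem finite_max_eq (n : ℕ+) : {e : Edge | e.max = n}.Finite := by
  refine (Set.finite_range fun i : Set.Iio n => mk' i.1 n i.2).subset ?_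
  intro e he
  obtain ⟨i, m, h, rfl⟩ := e.exists_eq_mk'
  obtain rfl : m = n := (max_mk' i m h).symm.trans he
  exact ⟨⟨i, h⟩, rfl⟩

end Edge

/-- The finite set of the edges `{i,j}` with `max(i,j) = n`. -/
noncomputable def edgesWithMax (n : ℕ+) : Finset Edge := (Edge.finite_max_eq n).toFinset

/-! ### The condition -/

/-- The total mass `∑ μ_{ij}` of the edges `{i,j}` with `max(i,j) > n`. -/
noncomputable def tailMass (μ : Measure Edge) (n : ℕ+) : ℝ :=
  ∑' e : {e : Edge // n < e.max}, μ.real {e.1}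

/-- The `n`-th integral: `∏_{max(i,j)=n} (1 - e^{-μ_{ij} t})` integrated over `t > 0` against the
exponential density whose rate is the mass of the edges with `max(i,j) > n`. -/
noncomputable def factor (μ : Measure Edge) (n : ℕ+) : ℝ :=
  ∫ t in Set.Ioi (0 : ℝ),
    (∏ e ∈ edgesWithMax n, (1 - Real.exp (-(μ.real {e} * t)))) *
      (tailMass μ n * Real.exp (-(tailMass μ n * t)))

/-- The vertex set of the support of `μ`: the endpoints of the edges of positive probability. -/
def supportVerts (μ : Measure Edge) : Set ℕ+ :=
  {v | ∃ e : Edge, v ∈ e.toSym2 ∧ 0 < μ {e}}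

/-! ### Graphs -/

/-- Graphs whose vertices are some of the positive integers (each graph has its own vertex set),
without loops and parallel edges. -/
abbrev Graph : Type := (⊤ : SimpleGraph ℕ+).Subgraph

/-- The graph with edge set `S` and no other vertices than the endpoints of the edges in `S`. -/
def graphOfEdges (S : Set Edge) : Graph where
  verts := {v | ∃ e ∈ S, v ∈ e.toSym2}
  Adj i j := ∃ e ∈ S, e.toSym2 = s(i, j)
  adj_sub := by
    rintro i j ⟨e, -, he⟩
    have h := e.not_isDiag
    rw [he] at h
    simpa using h
  edge_vert := by
    rintro i j ⟨e, heS, he⟩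
    exact ⟨e, heS, by rw [he]; exact Sym2.mem_mk_left i j⟩
  symm := ⟨fun i j ⟨e, heS, he⟩ => ⟨e, heS, by rw [he]; exact Sym2.eq_swap⟩⟩

/-- Essentially complete: connected, with vertex set `{1, …, n, n+1}` for some `n ≥ 1`, and any two
distinct vertices among `1, …, n` are adjacent. -/
def EssentiallyComplete (G : Graph) : Prop :=
  G.Connected ∧ ∃ n : ℕ+, G.verts = Set.Iic (n + 1) ∧ (Set.Iic n).Pairwise G.Adj

/-- The path `x` has the property `A` eventually forever. -/
def EventuallyForever {I 𝓧 : Type*} [Preorder I] (A : 𝓧 → Prop) (x : I → 𝓧) : Prop :=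
  ∃ i : I, ∀ j : I, i < j → A (x j)

/-! ### The two graph processes -/

/-- The discrete time process after identifying parallel edges: `G_0` is empty and
`G_{n+1} = G_n ∪ e_{n+1}`; the sequence `x` lists `e_1, e_2, …` starting from index `0`. -/
def discreteGraph (x : ℕ → Edge) : ℕ → Graph
  | 0 => ⊥
  | n + 1 => discreteGraph x n ⊔ graphOfEdges {x n}

/-- `N` is a Poisson process with intensity `r` (possibly `0`) under `P`: it starts at `0`, has
nondecreasing right-continuous paths almost surely, and has independent increments, where the
increment over `(s, t]` is Poisson distributed with mean `r (t - s)`. -/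
structure IsPoissonProcess {Ω : Type*} [MeasurableSpace Ω] (N : ℝ≥0 → Ω → ℕ) (r : ℝ≥0)
    (P : Measure Ω) : Prop where
  measurable : ∀ t, Measurable (N t)
  zero : ∀ᵐ ω ∂P, N 0 ω = 0
  monotone : ∀ᵐ ω ∂P, Monotone fun t => N t ω
  rightCts : ∀ᵐ ω ∂P, ∀ t, ContinuousWithinAt (fun u => N u ω) (Set.Ici t) t
  indep : HasIndepIncrements N P
  law : ∀ s t, s ≤ t → HasLaw (fun ω => N t ω - N s ω) (poissonMeasure (r * (t - s))) P

/-- The continuous time process after identifying parallel edges: at time `t` the edges are the `e`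
with `N_e(t) > 0`, and the vertices are their endpoints. -/
def continuousGraph (c : Edge → ℝ≥0 → ℕ) (t : ℝ≥0) : Graph :=
  graphOfEdges {e | 0 < c e t}

end EdgeProcess

open EdgeProcess

/-! Call `max(i,j)` the level of an edge and let `t e` be its arrival time, `∞` if it never comes. A
nonempty finite graph is essentially complete iff it contains every edge of level below that of its
highest edge. So if every edge comes, and only finitely many by any given time, the process is
eventually forever essentially complete iff from some level on all edges of level `n` come no later
than any higher edge (`CompleteBefore`).

These events are independent with probabilities `factor μ n`. Inclusion-exclusion over sets `S` of
edges of level `n` reduces this to the event that each edge of `S` is preceded by one of a set `A`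
of higher edges. By lack of memory its probability is `μ(A) / (μ(A) + μ(S))`, independently of the
order of arrival inside `A` (`measure_precededBy_inter`); integrating the expanded product in
`factor` gives the same sum (`factor_eq_sum`). Only finitely many edges are compared at a time, so
levels above `K` are ignored first, and then `K → ∞`.

By independence, the probability that all levels above `m` are good, times the product of the
factors up to `m`, is `L`. If `L > 0`, it tends to `1`; if `L = 0` and all factors are positive, it
is `0` for every `m`. An edge of mass zero makes `L` vanish; it never comes, but a higher edge does,
since the support is unbounded.

Both time scales enter only through `MemorylessArrivals`: the first step has length `h = 1` in
discrete time and `h → 0+` in continuous time. -/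

namespace EdgeProcess

section ENNRealNotation

open scoped ENNReal

section

/-! ### Edges -/

instance : DiscreteMeasurableSpace Edge := ⟨fun _ => trivial⟩

noncomputable instance : DecidableEq Edge := Classical.decEq _

instance : Countable Edge :=
  Function.Injective.countable (f := Edge.toSym2) fun _ _ h => Edge.ext h

theorem mem_edgesWithMax {n : ℕ+} {e : Edge} : e ∈ edgesWithMax n ↔ e.max = n := by
  simp [edgesWithMax]

theorem Edge.mem_mk' {i n v : ℕ+} (h : i < n) :
    v ∈ (Edge.mk' i n h).toSym2 ↔ v = i ∨ v = n := Sym2.mem_iff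

theorem Edge.le_max {e : Edge} {v : ℕ+} (hv : v ∈ e.toSym2) : v ≤ e.max := by
  obtain ⟨i, n, h, rfl⟩ := e.exists_eq_mk'
  rw [Edge.max_mk']
  rcases (Edge.mem_mk' h).1 hv with rfl | rfl
  · exact h.le
  · exact le_rfl

theorem Edge.max_mem (e : Edge) : e.max ∈ e.toSym2 := by
  obtain ⟨i, n, h, rfl⟩ := e.exists_eq_mk'
  rw [Edge.max_mk']
  exact (Edge.mem_mk' h).2 (Or.inr rfl)

/-- The finite set of edges with larger endpoint in `(n, K]`. -/
noncomputable def edgesBetween (n K : ℕ+) : Finset Edge := (Finset.Ioc n K).biUnion edgesWithMax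

theorem mem_edgesBetween {n K : ℕ+} {e : Edge} :
    e ∈ edgesBetween n K ↔ n < e.max ∧ e.max ≤ K := by
  simp [edgesBetween, mem_edgesWithMax]

/-! ### Essential completeness in terms of arrival times -/

/-- All the edges with larger endpoint `n` come no later than the first edge with a larger endpoint
above `n`. -/
def CompleteBefore (t : Edge → ℝ≥0∞) (n : ℕ+) : Prop :=
  ∀ e f : Edge, e.max = n → n < f.max → t e ≤ t f

theorem graphOfEdges_adj_mk' {S : Set Edge} {i n : ℕ+} (h : i < n) :
    (graphOfEdges S).Adj i n ↔ Edge.mk' i n h ∈ S := by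
  constructor
  · rintro ⟨e, heS, he⟩
    rwa [show Edge.mk' i n h = e from Edge.ext he.symm]
  · exact fun hS => ⟨_, hS, rfl⟩

theorem graphOfEdges_adj_of_forall {S : Set Edge} {m : ℕ+} (h : ∀ e : Edge, e.max ≤ m → e ∈ S) :
    (Set.Iic m).Pairwise (graphOfEdges S).Adj := by
  intro i hi j hj hij
  rcases lt_or_gt_of_ne hij with hlt | hlt
  · exact (graphOfEdges_adj_mk' hlt).2 (h _ (by rw [Edge.max_mk']; exact hj))
  · exact ((graphOfEdges_adj_mk' hlt).2 (h _ (by rw [Edge.max_mk']; exact hi))).symm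

theorem connected_of_forall_adj {G : Graph} {c : ℕ+} (hc : c ∈ G.verts)
    (h : ∀ v ∈ G.verts, v ≠ c → G.Adj c v) : G.Connected := by
  rw [SimpleGraph.Subgraph.connected_iff', SimpleGraph.connected_iff_exists_forall_reachable]
  refine ⟨⟨c, hc⟩, fun ⟨v, hv⟩ => ?_⟩
  by_cases hvc : v = c
  · subst hvc; exact SimpleGraph.Reachable.refl _
  · exact SimpleGraph.Adj.reachable (by simpa using h v hv hvc)

/-- If `k` is the largest vertex and all the edges below `k` are there, the graph is essentially
complete. -/
theorem essentiallyComplete_graphOfEdges {S : Set Edge} {f : Edge} (hf : f ∈ S)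
    (hmax : ∀ e ∈ S, e.max ≤ f.max) (hall : ∀ e : Edge, e.max < f.max → e ∈ S) :
    EssentiallyComplete (graphOfEdges S) := by
  obtain ⟨i, k, hik, rfl⟩ := f.exists_eq_mk'
  simp only [Edge.max_mk'] at hmax hall
  obtain ⟨n, rfl⟩ : ∃ n : ℕ+, k = n + 1 :=
    PNat.exists_eq_succ_of_ne_one (fun h => by subst h; exact absurd hik (not_lt_one))
  have hpair : (Set.Iic n).Pairwise (graphOfEdges S).Adj :=
    graphOfEdges_adj_of_forall fun e he => hall e (PNat.lt_add_one_iff.2 he)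
  have hin : i ≤ n := PNat.lt_add_one_iff.1 hik
  have hadj : ∀ v ≤ n + 1, v ≠ i → (graphOfEdges S).Adj i v := by
    intro v hv hvi
    rcases hv.lt_or_eq with hlt | rfl
    · exact hpair hin (PNat.lt_add_one_iff.1 hlt) hvi.symm
    · exact (graphOfEdges_adj_mk' hik).2 hf
  have hverts : (graphOfEdges S).verts = Set.Iic (n + 1) := by
    ext v
    constructor
    · rintro ⟨e, he, hv⟩
      exact (Edge.le_max hv).trans (hmax e he)
    · intro hv
      by_cases hvi : v = i
      · subst hvi
        exact ⟨_, hf, (Edge.mem_mk' hik).2 (Or.inl rfl)⟩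
      · exact (graphOfEdges S).edge_vert (hadj v hv hvi).symm
  refine ⟨connected_of_forall_adj (c := i) ?_ ?_, n, hverts, hpair⟩
  · rw [hverts]; exact hik.le
  · rw [hverts]; exact hadj

/-- In an essentially complete graph on the edges `S`, all the edges below the largest vertex
occur. -/
theorem EssentiallyComplete.mem_of_max_lt {S : Set Edge} (h : EssentiallyComplete (graphOfEdges S))
    {e f : Edge} (hf : f ∈ S) (hef : e.max < f.max) : e ∈ S := by
  obtain ⟨-, n, hV, hpair⟩ := h
  have hfn : f.max ≤ n + 1 := by
    have : f.max ∈ (graphOfEdges S).verts := ⟨f, hf, f.max_mem⟩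
    rwa [hV] at this
  have hen : e.max ≤ n := PNat.lt_add_one_iff.1 (hef.trans_le hfn)
  obtain ⟨i, k, hik, rfl⟩ := e.exists_eq_mk'
  rw [Edge.max_mk'] at hen
  exact (graphOfEdges_adj_mk' hik).1 (hpair (hik.le.trans hen) hen hik.ne)

section Deterministic

variable {I : Type*} [LinearOrder I] {ι : I → ℝ≥0∞} {t : Edge → ℝ≥0∞}

/-- Wait for the finitely many edges of level at most `m + 1`. Afterwards, any edge below the
highest present edge `f` is one of these or comes no later than `f` by `CompleteBefore`. -/
theorem eventuallyForever_of_completeBefore [Nonempty I] (hι : StrictMono ι) (ht : ∀ e, ∃ i, t e = ι i)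
    (hfin : ∀ i, {e | t e ≤ ι i}.Finite) {m : ℕ+} (hm : ∀ n, m ≤ n → CompleteBefore t n) :
    EventuallyForever EssentiallyComplete fun i => graphOfEdges {e | t e ≤ ι i} := by
  choose τ hτ using ht
  obtain ⟨i₀, hi₀⟩ := (((Finset.Icc 1 (m + 1)).biUnion edgesWithMax).image τ).exists_le
  have hinit : ∀ e : Edge, e.max ≤ m + 1 → τ e ≤ i₀ := fun e he =>
    hi₀ _ (Finset.mem_image_of_mem τ (by simp [mem_edgesWithMax, he]))
  refine ⟨i₀, fun i hi => ?_⟩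
  have hmem : ∀ e : Edge, e.max ≤ m + 1 → e ∈ {e | t e ≤ ι i} := fun e he => by
    simpa [hτ, hι.le_iff_le] using (hinit e he).trans hi.le
  have h12 : (1 : ℕ+) < 1 + 1 := PNat.lt_add_one_iff.2 le_rfl
  -- The bound `m + 1`, rather than `m`, ensures that the edge `{1,2}` is present even if `m = 1`.
  have hne : ({e | t e ≤ ι i} : Set Edge).Nonempty :=
    ⟨Edge.mk' 1 (1 + 1) h12, hmem _ (by rw [Edge.max_mk']; gcongr; exact one_le)⟩
  obtain ⟨f, hf, hmax⟩ := Set.exists_max_image _ Edge.max (hfin i) hne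
  refine essentiallyComplete_graphOfEdges hf hmax fun e he => ?_
  by_cases hem : e.max ≤ m + 1
  · exact hmem e hem
  · have : m ≤ e.max := ((PNat.lt_add_right m 1).le).trans (not_le.1 hem).le
    exact (hm _ this e f rfl he).trans hf

/-- Choose `m` above the levels of the finitely many edges present at `i₀`. A higher edge `f` comes
after `i₀`, and the graph at the very time of its arrival already contains all lower edges. -/
theorem completeBefore_of_eventuallyForever (hι : StrictMono ι) (ht : ∀ e, ∃ i, t e = ι i)
    (hfin : ∀ i, {e | t e ≤ ι i}.Finite)
    (h : EventuallyForever EssentiallyComplete fun i => graphOfEdges {e | t e ≤ ι i}) :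
    ∃ m : ℕ+, ∀ n, m ≤ n → CompleteBefore t n := by
  obtain ⟨i₀, hi₀⟩ := h
  obtain ⟨m, hm⟩ : ∃ m : ℕ+, ∀ e ∈ (hfin i₀).toFinset, e.max ≤ m :=
    ((hfin i₀).toFinset.image Edge.max).exists_le.imp fun m hm e he =>
      hm _ (Finset.mem_image_of_mem _ he)
  refine ⟨m, fun n hn e f he hf => ?_⟩
  by_contra hlt
  rw [not_le] at hlt
  obtain ⟨i, hi⟩ := ht f
  have hi₀i : i₀ < i := by
    by_contra hle
    have := hm f (by simpa [hi] using hι.monotone (not_lt.1 hle))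
    exact absurd (hn.trans_lt hf) (not_lt.2 this)
  have := (hi₀ i hi₀i).mem_of_max_lt (e := e) (f := f) hi.le (he ▸ hf)
  exact absurd (this : t e ≤ ι i) (not_le.2 (hi ▸ hlt))

theorem not_eventuallyForever_of_eq_top [NoMaxOrder I] (hι : StrictMono ι)
    (ht : ∀ e, t e ≠ ∞ → ∃ i, t e = ι i) {e : Edge} (he : t e = ∞)
    (hunb : ∃ f : Edge, e.max < f.max ∧ t f ≠ ∞) :
    ¬ EventuallyForever EssentiallyComplete fun i => graphOfEdges {e | t e ≤ ι i} := by
  rintro ⟨i₀, hi₀⟩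
  obtain ⟨f, hef, hf⟩ := hunb
  obtain ⟨i, hi⟩ := ht f hf
  obtain ⟨j, hj⟩ := exists_gt (max i₀ i)
  -- A later index serves only to show that `ι j` is finite.
  obtain ⟨j', hj'⟩ := exists_gt j
  have hmem := (hi₀ j ((le_max_left _ _).trans_lt hj)).mem_of_max_lt (e := e) (f := f)
    (by simpa [hi] using hι.monotone ((le_max_right _ _).trans hj.le)) hef
  have hle : t e ≤ ι j := hmem
  rw [he, top_le_iff] at hle
  exact absurd (hι hj') (by simp [hle])

end Deterministic

/-! ### The discrete graph as the graph of the edges drawn so far -/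

theorem graphOfEdges_union (S S' : Set Edge) :
    graphOfEdges (S ∪ S') = graphOfEdges S ⊔ graphOfEdges S' := by
  apply SimpleGraph.Subgraph.ext
  · ext v
    simp [graphOfEdges, or_and_right, exists_or]
  · ext i j
    simp [graphOfEdges, or_and_right, exists_or]

theorem graphOfEdges_empty : graphOfEdges ∅ = ⊥ := by
  apply SimpleGraph.Subgraph.ext
  · ext v
    simp [graphOfEdges]
  · ext i j
    simp [graphOfEdges]

theorem discreteGraph_eq (x : ℕ → Edge) (n : ℕ) :
    discreteGraph x n = graphOfEdges {e | ∃ k < n, x k = e} := by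
  induction n with
  | zero => simp [discreteGraph, graphOfEdges_empty]
  | succ n ih =>
    rw [discreteGraph, ih, ← graphOfEdges_union]
    congr 1
    ext e
    simp only [Set.mem_union, Set.mem_ofPred_eq, Set.mem_singleton_iff, Nat.lt_succ_iff_lt_or_eq]
    grind

end

section

/-! ### The factors -/

/-- The set of edges with larger endpoint above `n`. -/
def edgesAbove (n : ℕ+) : Set Edge := {e | n < e.max}

theorem tailMass_eq (μ : Measure Edge) [IsProbabilityMeasure μ] (n : ℕ+) :
    tailMass μ n = μ.real (edgesAbove n) := by
  have h := tsum_measure_preimage_singleton (μ := μ) (Set.to_countable (edgesAbove n)) (f := id)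
    fun _ _ => trivial
  simp only [Set.preimage_id] at h
  rw [measureReal_def, ← h, ENNReal.tsum_toReal_eq fun _ => measure_ne_top _ _]
  rfl

theorem integrableOn_exp_neg {a : ℝ} (ha : 0 < a) :
    IntegrableOn (fun t : ℝ => Real.exp (-(a * t))) (Set.Ioi 0) := by
  simpa [neg_mul] using integrableOn_exp_mul_Ioi (neg_neg_of_pos ha) 0

theorem integral_exp_neg {a : ℝ} (ha : 0 < a) :
    ∫ t in Set.Ioi (0 : ℝ), Real.exp (-(a * t)) = 1 / a := by
  have := integral_exp_mul_Ioi (neg_neg_of_pos ha) 0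
  simpa [neg_mul, neg_div] using this

theorem factor_integrand_eq (μ : Measure Edge) (n : ℕ+) (t : ℝ) :
    (∏ e ∈ edgesWithMax n, (1 - Real.exp (-(μ.real {e} * t)))) *
      (tailMass μ n * Real.exp (-(tailMass μ n * t))) =
    ∑ S ∈ (edgesWithMax n).powerset, (-1) ^ S.card * tailMass μ n *
      Real.exp (-((tailMass μ n + ∑ e ∈ S, μ.real {e}) * t)) := by
  simp_rw [sub_eq_add_neg, Finset.prod_one_add, Finset.sum_mul]
  refine Finset.sum_congr rfl fun S _ => ?_
  rw [Finset.prod_neg, ← Real.exp_sum, add_mul, neg_add, Real.exp_add, Finset.sum_mul,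
    Finset.sum_neg_distrib]
  ring

/-- Each summand is, up to sign, the probability that an exponential clock of rate `tailMass μ n`
rings before an independent one of rate `μ(S)`; in this form the factor is matched with the order of
arrivals. -/
theorem factor_eq_sum (μ : Measure Edge) (n : ℕ+) (hΛ : 0 < tailMass μ n) :
    factor μ n = ∑ S ∈ (edgesWithMax n).powerset, (-1) ^ S.card *
      (tailMass μ n / (tailMass μ n + ∑ e ∈ S, μ.real {e})) := by
  have hpos : ∀ S : Finset Edge, 0 < tailMass μ n + ∑ e ∈ S, μ.real {e} := fun S =>
    add_pos_of_pos_of_nonneg hΛ (Finset.sum_nonneg fun _ _ => measureReal_nonneg)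
  rw [factor]
  simp_rw [factor_integrand_eq]
  rw [integral_finsetSum _ fun S _ => (integrableOn_exp_neg (hpos S)).const_mul _]
  refine Finset.sum_congr rfl fun S _ => ?_
  rw [integral_const_mul, integral_exp_neg (hpos S)]
  ring

theorem factor_pos (μ : Measure Edge) (n : ℕ+) (hΛ : 0 < tailMass μ n)
    (hμ : ∀ e, 0 < μ.real {e}) : 0 < factor μ n := by
  have hpos : ∀ t ∈ Set.Ioi (0 : ℝ), 0 <
      (∏ e ∈ edgesWithMax n, (1 - Real.exp (-(μ.real {e} * t)))) *
      (tailMass μ n * Real.exp (-(tailMass μ n * t))) := by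
    intro t ht
    have : ∀ e ∈ edgesWithMax n, 0 < 1 - Real.exp (-(μ.real {e} * t)) := fun e _ => by
      have := mul_pos (hμ e) (show 0 < t from ht)
      simpa using this
    have := Finset.prod_pos this
    positivity
  rw [factor, setIntegral_pos_iff_support_of_nonneg_ae]
  · have : (Function.support fun t : ℝ =>
        (∏ e ∈ edgesWithMax n, (1 - Real.exp (-(μ.real {e} * t)))) *
        (tailMass μ n * Real.exp (-(tailMass μ n * t)))) ∩ Set.Ioi 0 = Set.Ioi 0 :=
      Set.inter_eq_right.2 fun t ht => (hpos t ht).ne'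
    rw [this]
    simp
  · exact (ae_restrict_iff' measurableSet_Ioi).2 (ae_of_all _ fun t ht => (hpos t ht).le)
  · simp_rw [factor_integrand_eq]
    refine integrable_finsetSum _ fun S _ => (integrableOn_exp_neg ?_).const_mul _
    exact add_pos_of_pos_of_nonneg hΛ (Finset.sum_nonneg fun _ _ => measureReal_nonneg)

theorem factor_eq_zero (μ : Measure Edge) {e : Edge} (he : μ.real {e} = 0) :
    factor μ e.max = 0 := by
  have : ∀ t : ℝ, ∏ f ∈ edgesWithMax e.max, (1 - Real.exp (-(μ.real {f} * t))) = 0 := fun t =>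
    Finset.prod_eq_zero (mem_edgesWithMax.2 rfl) (by simp [he])
  simp [factor, this]

end

section

variable {Ω : Type*} [MeasurableSpace Ω] {P : Measure Ω} {μ : Measure Edge}
  {T : Ω → Edge → ℝ≥0∞}

/-! ### Memoryless families of arrival times -/

/-- A measurable set of families of times that depends only on the times of the edges in `W` and
does not change when as long a time as possible is cut off the beginning. -/
structure ShiftInvariantOn (W : Finset Edge) (G : Set (Edge → ℝ≥0∞)) : Prop where
  measurableSet : MeasurableSet G
  congr : ∀ t t' : Edge → ℝ≥0∞, (∀ e ∈ W, t e = t' e) → t ∈ G → t' ∈ G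
  shift : ∀ (h : ℝ≥0∞) (t : Edge → ℝ≥0∞), (∀ e ∈ W, h < t e) →
    (t ∈ G ↔ (fun e => t e - h) ∈ G)

theorem ShiftInvariantOn.mono {W W' : Finset Edge} {G : Set (Edge → ℝ≥0∞)}
    (hG : ShiftInvariantOn W G) (hW : W ⊆ W') : ShiftInvariantOn W' G where
  measurableSet := hG.measurableSet
  congr t t' h := hG.congr t t' fun e he => h e (hW he)
  shift h t ht := hG.shift h t fun e he => ht e (hW he)

theorem ShiftInvariantOn.inter {W : Finset Edge} {G G' : Set (Edge → ℝ≥0∞)}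
    (hG : ShiftInvariantOn W G) (hG' : ShiftInvariantOn W G') : ShiftInvariantOn W (G ∩ G') where
  measurableSet := hG.measurableSet.inter hG'.measurableSet
  congr t t' h ht := ⟨hG.congr t t' h ht.1, hG'.congr t t' h ht.2⟩
  shift h t ht := and_congr (hG.shift h t ht) (hG'.shift h t ht)

theorem ShiftInvariantOn.compl {W : Finset Edge} {G : Set (Edge → ℝ≥0∞)}
    (hG : ShiftInvariantOn W G) : ShiftInvariantOn W Gᶜ where
  measurableSet := hG.measurableSet.compl
  congr t t' h ht ht' := ht (hG.congr t' t (fun e he => (h e he).symm) ht')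
  shift h t ht := not_congr (hG.shift h t ht)

theorem shiftInvariantOn_univ (W : Finset Edge) : ShiftInvariantOn W Set.univ where
  measurableSet := .univ
  congr _ _ _ h := h
  shift _ _ _ := Iff.rfl

theorem ShiftInvariantOn.biInter {W : Finset Edge} {α : Type*} (J : Finset α)
    {G : α → Set (Edge → ℝ≥0∞)} (hG : ∀ a ∈ J, ShiftInvariantOn W (G a)) :
    ShiftInvariantOn W (⋂ a ∈ J, G a) := by
  classical
  induction J using Finset.induction_on with
  | empty => simpa using shiftInvariantOn_univ W
  | insert a J _ ih =>
    rw [Finset.set_biInter_insert]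
    exact (hG a (Finset.mem_insert_self a J)).inter
      (ih fun b hb => hG b (Finset.mem_insert_of_mem hb))

theorem shiftInvariantOn_lt {W : Finset Edge} {e f : Edge} (he : e ∈ W) (hf : f ∈ W) :
    ShiftInvariantOn W {t | t e < t f} where
  measurableSet := measurableSet_lt (measurable_pi_apply e) (measurable_pi_apply f)
  congr t t' h ht := by
    change t' e < t' f
    rw [← h e he, ← h f hf]
    exact ht
  shift h t ht := by
    -- Truncated subtraction preserves strict order here because `h` is finite and at most `t e`; `t
    -- f = ∞` is allowed.
    have hh : h ≠ ∞ := (ht e he).ne_top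
    change t e < t f ↔ t e - h < t f - h
    exact ((ENNReal.cancel_of_ne hh).tsub_lt_tsub_iff_right (ht e he).le).symm

theorem shiftInvariantOn_eq_top {W : Finset Edge} {e : Edge} (he : e ∈ W) :
    ShiftInvariantOn W {t | t e = ∞} where
  measurableSet := measurableSet_eq_fun (measurable_pi_apply e) measurable_const
  congr t t' h ht := (h e he).symm.trans ht
  shift h t ht := by
    have hh : h ≠ ∞ := (ht e he).ne_top
    change t e = ∞ ↔ t e - h = ∞
    simp [ENNReal.sub_eq_top_iff, hh]

/-- The event that no edge in `W` has arrived up to time `h`. -/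
def noneUpTo (T : Ω → Edge → ℝ≥0∞) (W : Finset Edge) (h : ℝ) : Set Ω :=
  {ω | ∀ e ∈ W, ENNReal.ofReal h < T ω e}

/-- Waiting until time `h` for the edges in `W` in vain has no influence on the order in which they
will arrive. -/
def MemorylessAt (P : Measure Ω) (T : Ω → Edge → ℝ≥0∞) (h : ℝ) : Prop :=
  ∀ (W : Finset Edge) (G : Set (Edge → ℝ≥0∞)), ShiftInvariantOn W G →
    P.real (noneUpTo T W h ∩ T ⁻¹' G) = P.real (noneUpTo T W h) * P.real (T ⁻¹' G)

/-- Random arrival times of the edges that have no memory, where `μ` gives the rates of arrival. This covers both discrete time, where `l` is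
concentrated on `1`, and continuous time, where `l` is the filter of small positive numbers. -/
structure MemorylessArrivals (μ : Measure Edge) (P : Measure Ω) (T : Ω → Edge → ℝ≥0∞)
    (l : Filter ℝ) : Prop where
  measurable : Measurable T
  measure_le : ∀ (e : Edge) (k : ℕ), P {ω | T ω e ≤ k} ≤ k * μ {e}
  memoryless : ∀ᶠ h in l, MemorylessAt P T h
  rate : ∀ W : Finset Edge,
    Tendsto (fun h => P.real (noneUpTo T W h)ᶜ / h) l (𝓝 (μ.real W))

/-- Every edge in `S` comes after some edge in `A`. -/
def precededBy (A S : Finset Edge) : Set (Edge → ℝ≥0∞) :=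
  {t | ∀ e ∈ S, ∃ f ∈ A, t f < t e}

theorem shiftInvariantOn_precededBy (A S : Finset Edge) :
    ShiftInvariantOn (A ∪ S) (precededBy A S) := by
  have : precededBy A S = ⋂ e ∈ S, (⋂ f ∈ A, {t | t f < t e}ᶜ)ᶜ := by
    ext t
    simp [precededBy]
  rw [this]
  exact .biInter _ fun e he => (ShiftInvariantOn.biInter _ fun f hf =>
    (shiftInvariantOn_lt (Finset.mem_union_left S hf) (Finset.mem_union_right A he)).compl).compl

namespace MemorylessArrivals

variable {l : Filter ℝ}

theorem measurableSet_noneUpTo (hT : Measurable T) (W : Finset Edge) (h : ℝ) :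
    MeasurableSet (noneUpTo T W h) := by
  have : noneUpTo T W h = ⋂ e ∈ W, {ω | ENNReal.ofReal h < T ω e} := by
    ext ω
    simp [noneUpTo]
  rw [this]
  exact W.measurableSet_biInter fun e _ =>
    measurableSet_lt measurable_const ((measurable_pi_apply e).comp hT)

/-- The rates are additive in `W`, so inclusion-exclusion leaves rate `0` for the joint arrival of
two distinct edges. -/
theorem tendsto_overlap [IsFiniteMeasure P] [IsFiniteMeasure μ]
    (hT : MemorylessArrivals μ P T l) {e f : Edge} (hef : e ≠ f) :
    Tendsto (fun h => P.real {ω | T ω e ≤ ENNReal.ofReal h ∧ T ω f ≤ ENNReal.ofReal h} / h) l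
      (𝓝 0) := by
  have hμ : μ.real ({e} : Finset Edge) + μ.real ({f} : Finset Edge) -
      μ.real ({e, f} : Finset Edge) = 0 := by
    rw [Finset.coe_pair, Set.insert_eq, measureReal_union (by simpa using hef) (.singleton f)]
    simp
  rw [← hμ]
  refine (((hT.rate {e}).add (hT.rate {f})).sub (hT.rate {e, f})).congr fun h => ?_
  have h1 : {ω | T ω e ≤ ENNReal.ofReal h ∧ T ω f ≤ ENNReal.ofReal h} =
      (noneUpTo T {e} h)ᶜ ∩ (noneUpTo T {f} h)ᶜ := by
    ext ω
    simp [noneUpTo]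
  have h2 : (noneUpTo T {e, f} h)ᶜ = (noneUpTo T {e} h)ᶜ ∪ (noneUpTo T {f} h)ᶜ := by
    ext ω
    simp [noneUpTo, imp_iff_not_or]
  have h3 := measureReal_union_add_inter (μ := P) (s := (noneUpTo T {e} h)ᶜ)
    (measurableSet_noneUpTo hT.measurable {f} h).compl
  rw [h1, h2, ← add_div, ← sub_div]
  congr 1
  linarith

/-- First-step analysis: the first edge of `A ∪ S` belongs to `A` with probability
`μ A / μ (A ∪ S)`, independently of the order in which the edges of `A` arrive. -/
theorem measure_precededBy_inter [IsProbabilityMeasure P] [IsFiniteMeasure μ] [l.NeBot]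
    (hT : MemorylessArrivals μ P T l) {A S : Finset Edge} (hAS : Disjoint A S)
    {R : Set (Edge → ℝ≥0∞)} (hR : ShiftInvariantOn A R) (hl : ∀ᶠ h in l, 0 < h) :
    P.real (T ⁻¹' (precededBy A S ∩ R)) * μ.real (A ∪ S : Finset Edge) =
      P.real (T ⁻¹' R) * μ.real A := by
  set Q := T ⁻¹' (precededBy A S ∩ R) with hQdef
  have hQ : ShiftInvariantOn (A ∪ S) (precededBy A S ∩ R) :=
    (shiftInvariantOn_precededBy A S).inter (hR.mono Finset.subset_union_left)
  have hQm : MeasurableSet Q := hT.measurable hQ.measurableSet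
  have hRm : MeasurableSet (T ⁻¹' R) := hT.measurable hR.measurableSet
  -- Compare `R` together with an arrival in `A` up to `h`, and `Q` together with an arrival in `A ∪
  -- S` up to `h`. The former event contains the latter, and they differ only if both `A` and `S`
  -- have arrivals up to `h`, which has rate `0`. Lack of memory factorizes both probabilities.
  have key : ∀ᶠ h in l, |P.real (noneUpTo T A h)ᶜ / h * P.real (T ⁻¹' R) -
      P.real (noneUpTo T (A ∪ S) h)ᶜ / h * P.real Q| ≤
      ∑ p ∈ A ×ˢ S,
        P.real {ω | T ω p.1 ≤ ENNReal.ofReal h ∧ T ω p.2 ≤ ENNReal.ofReal h} / h := by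
    filter_upwards [hT.memoryless, hl] with h hh hpos
    have split : ∀ {W : Finset Edge} {G : Set (Edge → ℝ≥0∞)}, ShiftInvariantOn W G →
        P.real (noneUpTo T W h)ᶜ * P.real (T ⁻¹' G) = P.real (T ⁻¹' G ∩ (noneUpTo T W h)ᶜ) := by
      intro W G hG
      have h1 := hh W G hG
      have hm := measurableSet_noneUpTo hT.measurable W h
      have h2 := measureReal_inter_add_sdiff (μ := P) (s := T ⁻¹' G) hm
      rw [probReal_compl_eq_one_sub hm, ← Set.sdiff_eq]
      rw [Set.inter_comm] at h1
      linarith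
    have hsub : Q ∩ (noneUpTo T (A ∪ S) h)ᶜ ⊆ T ⁻¹' R ∩ (noneUpTo T A h)ᶜ := by
      rintro ω ⟨⟨hω, hωR⟩, hω'⟩
      refine ⟨hωR, fun hnone => hω' fun e he => ?_⟩
      rcases Finset.mem_union.1 he with he | he
      · exact hnone e he
      · obtain ⟨f, hf, hfe⟩ := hω e he
        exact (hnone f hf).trans hfe
    have hdiff : T ⁻¹' R ∩ (noneUpTo T A h)ᶜ ⊆ (Q ∩ (noneUpTo T (A ∪ S) h)ᶜ) ∪
        ⋃ p ∈ A ×ˢ S, {ω | T ω p.1 ≤ ENNReal.ofReal h ∧ T ω p.2 ≤ ENNReal.ofReal h} := by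
      rintro ω ⟨hωR, hω⟩
      obtain ⟨f, hf, hfh⟩ : ∃ f ∈ A, T ω f ≤ ENNReal.ofReal h := by
        simpa [noneUpTo] using hω
      by_cases hS : ∃ e ∈ S, T ω e ≤ ENNReal.ofReal h
      · obtain ⟨e, he, heh⟩ := hS
        refine Or.inr (Set.mem_biUnion (x := (f, e)) ?_ ⟨hfh, heh⟩)
        simp [hf, he]
      · push Not at hS
        exact Or.inl ⟨⟨fun e he => ⟨f, hf, hfh.trans_lt (hS e he)⟩, hωR⟩,
          fun hn => absurd (hn f (Finset.mem_union_left _ hf)) (not_lt.2 hfh)⟩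
    have h1 : P.real (Q ∩ (noneUpTo T (A ∪ S) h)ᶜ) ≤ P.real (T ⁻¹' R ∩ (noneUpTo T A h)ᶜ) :=
      measureReal_mono hsub
    have h2 : P.real (T ⁻¹' R ∩ (noneUpTo T A h)ᶜ) ≤ P.real (Q ∩ (noneUpTo T (A ∪ S) h)ᶜ) +
        ∑ p ∈ A ×ˢ S, P.real {ω | T ω p.1 ≤ ENNReal.ofReal h ∧ T ω p.2 ≤ ENNReal.ofReal h} :=
      (measureReal_mono hdiff).trans ((measureReal_union_le _ _).trans
        (add_le_add_right (measureReal_biUnion_finset_le _ _) _))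
    rw [div_mul_eq_mul_div, div_mul_eq_mul_div, split hR, split hQ, ← sub_div,
      abs_of_nonneg (div_nonneg (sub_nonneg.2 h1) hpos.le), ← Finset.sum_div]
    gcongr
    linarith
  have hlim := (((hT.rate A).mul_const (P.real (T ⁻¹' R))).sub
    ((hT.rate (A ∪ S)).mul_const (P.real Q))).abs
  have hzero : Tendsto (fun h => ∑ p ∈ A ×ˢ S,
      P.real {ω | T ω p.1 ≤ ENNReal.ofReal h ∧ T ω p.2 ≤ ENNReal.ofReal h} / h) l (𝓝 0) := by
    rw [show (0 : ℝ) = ∑ p ∈ A ×ˢ S, 0 by simp]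
    refine tendsto_finsetSum _ fun p hp => hT.tendsto_overlap ?_
    rw [Finset.mem_product] at hp
    exact Finset.disjoint_iff_ne.1 hAS _ hp.1 _ hp.2
  have := le_of_tendsto_of_tendsto hlim hzero key
  have := abs_nonpos_iff.1 this
  linarith

end MemorylessArrivals

end

section

variable {Ω : Type*} [MeasurableSpace Ω] {P : Measure Ω} {μ : Measure Edge}
  {T : Ω → Edge → ℝ≥0∞} {l : Filter ℝ}

/-! ### Independence of the levels -/

/-- The edges with larger endpoint `n` come no later than those with larger endpoint in `(n, K]`. -/
def completeBeforeUpTo (K n : ℕ+) : Set (Edge → ℝ≥0∞) :=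
  {t | ∀ e ∈ edgesWithMax n, ∀ f ∈ edgesBetween n K, t e ≤ t f}

theorem shiftInvariantOn_completeBeforeUpTo (K n : ℕ+) :
    ShiftInvariantOn (edgesBetween n K ∪ edgesWithMax n) (completeBeforeUpTo K n) := by
  have : completeBeforeUpTo K n =
      ⋂ e ∈ edgesWithMax n, ⋂ f ∈ edgesBetween n K, {t | t f < t e}ᶜ := by
    ext t
    simp [completeBeforeUpTo]
  rw [this]
  exact .biInter _ fun e he => .biInter _ fun f hf =>
    (shiftInvariantOn_lt (Finset.mem_union_left _ hf) (Finset.mem_union_right _ he)).compl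

theorem disjoint_edgesBetween_edgesWithMax (n K : ℕ+) :
    Disjoint (edgesBetween n K) (edgesWithMax n) := by
  rw [Finset.disjoint_left]
  intro e he he'
  rw [mem_edgesBetween] at he
  rw [mem_edgesWithMax] at he'
  exact he.1.ne' he'

/-- The indicator is the product over `e` of one minus the indicator that a higher edge comes
strictly before `e`. Expanding it mirrors the expansion of `factor`. -/
theorem indicator_completeBeforeUpTo (K n : ℕ+) (t : Edge → ℝ≥0∞) :
    (completeBeforeUpTo K n).indicator (1 : (Edge → ℝ≥0∞) → ℝ) t =
      ∑ S ∈ (edgesWithMax n).powerset,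
        (-1) ^ S.card * (precededBy (edgesBetween n K) S).indicator (1 : (Edge → ℝ≥0∞) → ℝ) t := by
  classical
  have h : ∀ S : Finset Edge, (precededBy (edgesBetween n K) S).indicator (1 : (Edge → ℝ≥0∞) → ℝ) t =
      ∏ e ∈ S, if ∃ f ∈ edgesBetween n K, t f < t e then (1 : ℝ) else 0 := by
    intro S
    rw [Finset.prod_ite_zero]
    simp [Set.indicator_apply, precededBy]
  have h' : (completeBeforeUpTo K n).indicator (1 : (Edge → ℝ≥0∞) → ℝ) t =
      ∏ e ∈ edgesWithMax n, (1 - if ∃ f ∈ edgesBetween n K, t f < t e then (1 : ℝ) else 0) := by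
    have : ∀ e, (1 - if ∃ f ∈ edgesBetween n K, t f < t e then (1 : ℝ) else 0) =
        if ∀ f ∈ edgesBetween n K, t e ≤ t f then (1 : ℝ) else 0 := by
      intro e
      by_cases he : ∃ f ∈ edgesBetween n K, t f < t e
      · rw [if_pos he, if_neg (by push Not; exact he), sub_self]
      · rw [if_neg he, if_pos (by push Not at he; exact he), sub_zero]
    simp_rw [this]
    rw [Finset.prod_ite_zero]
    simp [Set.indicator_apply, completeBeforeUpTo]
  rw [h']
  simp_rw [sub_eq_add_neg, Finset.prod_one_add, Finset.prod_neg, h]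

/-- The analogue of `factor` where edges with larger endpoint above `K` are ignored. -/
noncomputable def truncatedFactor (μ : Measure Edge) (K n : ℕ+) : ℝ :=
  ∑ S ∈ (edgesWithMax n).powerset, (-1) ^ S.card *
    (μ.real (edgesBetween n K) / (μ.real (edgesBetween n K) + ∑ e ∈ S, μ.real {e}))

theorem tendsto_measureReal_edgesBetween (μ : Measure Edge) [IsProbabilityMeasure μ] (n : ℕ+) :
    Tendsto (fun K => μ.real (edgesBetween n K)) atTop (𝓝 (tailMass μ n)) := by
  have hmono : Monotone fun K => (edgesBetween n K : Set Edge) := by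
    intro K K' hK e he
    rw [Finset.mem_coe, mem_edgesBetween] at he ⊢
    exact ⟨he.1, he.2.trans hK⟩
  have hU : ⋃ K, (edgesBetween n K : Set Edge) = edgesAbove n := by
    ext e
    simp only [Set.mem_iUnion, Finset.mem_coe, mem_edgesBetween]
    exact ⟨fun ⟨K, h⟩ => h.1, fun h => ⟨e.max, h, le_rfl⟩⟩
  rw [tailMass_eq, ← hU]
  exact (ENNReal.tendsto_toReal (measure_ne_top _ _)).comp (tendsto_measure_iUnion_atTop hmono)

theorem tendsto_truncatedFactor (μ : Measure Edge) [IsProbabilityMeasure μ] {n : ℕ+}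
    (hΛ : 0 < tailMass μ n) :
    Tendsto (fun K => truncatedFactor μ K n) atTop (𝓝 (factor μ n)) := by
  rw [factor_eq_sum μ n hΛ]
  refine tendsto_finsetSum _ fun S _ => Tendsto.const_mul _ ?_
  have h := tendsto_measureReal_edgesBetween μ n
  refine h.div (h.add_const _) ?_
  exact (add_pos_of_pos_of_nonneg hΛ (Finset.sum_nonneg fun _ _ => measureReal_nonneg)).ne'

namespace MemorylessArrivals

/-- Take expectations in the indicator expansion and apply `measure_precededBy_inter` to each `S`,
with the edges of level in `(n, K]` as `A`; the factor `P(R)` comes out of every term. -/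
theorem measure_completeBeforeUpTo_inter [IsProbabilityMeasure P] [IsProbabilityMeasure μ] [l.NeBot]
    (hT : MemorylessArrivals μ P T l) (hl : ∀ᶠ h in l, 0 < h) {K n : ℕ+}
    (hK : 0 < μ.real (edgesBetween n K))
    {R : Set (Edge → ℝ≥0∞)} (hR : ShiftInvariantOn (edgesBetween n K) R) :
    P.real (T ⁻¹' (completeBeforeUpTo K n ∩ R)) = truncatedFactor μ K n * P.real (T ⁻¹' R) := by
  have hB := (shiftInvariantOn_completeBeforeUpTo K n).measurableSet
  have hP : ∀ S : Finset Edge, MeasurableSet (precededBy (edgesBetween n K) S ∩ R) := fun S =>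
    (shiftInvariantOn_precededBy _ S).measurableSet.inter hR.measurableSet
  have hint : ∀ G : Set (Edge → ℝ≥0∞), MeasurableSet G →
      P.real (T ⁻¹' G) = ∫ ω, G.indicator (1 : (Edge → ℝ≥0∞) → ℝ) (T ω) ∂P := by
    intro G hG
    rw [← integral_indicator_one (hT.measurable hG)]
    rfl
  have hintegrable : ∀ G : Set (Edge → ℝ≥0∞), MeasurableSet G →
      Integrable (fun ω => G.indicator (1 : (Edge → ℝ≥0∞) → ℝ) (T ω)) P := by
    intro G hG
    have : Integrable ((T ⁻¹' G).indicator (1 : Ω → ℝ)) P :=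
      (integrable_indicator_iff (hT.measurable hG)).2 (integrable_const (1 : ℝ)).integrableOn
    exact this
  have hsum : P.real (T ⁻¹' (completeBeforeUpTo K n ∩ R)) =
      ∑ S ∈ (edgesWithMax n).powerset,
        (-1) ^ S.card * P.real (T ⁻¹' (precededBy (edgesBetween n K) S ∩ R)) := by
    rw [hint _ (hB.inter hR.measurableSet)]
    simp_rw [hint _ (hP _), ← integral_const_mul]
    rw [← integral_finsetSum _ fun S _ => (hintegrable _ (hP S)).const_mul _]
    congr 1 with ω
    simp_rw [Set.inter_indicator_one, Pi.mul_apply, indicator_completeBeforeUpTo, Finset.sum_mul,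
      mul_assoc]
  rw [hsum, truncatedFactor, Finset.sum_mul]
  refine Finset.sum_congr rfl fun S hS => ?_
  have hdisj : Disjoint (edgesBetween n K) S :=
    (disjoint_edgesBetween_edgesWithMax n K).mono_right (Finset.mem_powerset.1 hS)
  have h := hT.measure_precededBy_inter hdisj hR hl
  have hμ : μ.real (edgesBetween n K ∪ S : Finset Edge) =
      μ.real (edgesBetween n K) + ∑ e ∈ S, μ.real {e} := by
    rw [Finset.coe_union, measureReal_union (by exact_mod_cast hdisj) S.measurableSet,
      sum_measureReal_singleton]
  rw [hμ] at h
  have hpos : 0 < μ.real (edgesBetween n K) + ∑ e ∈ S, μ.real {e} :=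
    add_pos_of_pos_of_nonneg hK (Finset.sum_nonneg fun _ _ => measureReal_nonneg)
  rw [mul_assoc, div_mul_eq_mul_div, mul_comm (μ.real _) (P.real _), ← h,
    mul_div_cancel_right₀ _ hpos.ne']

/-- Split off the lowest level `n`: the remaining events involve only edges of level in `(n, K]`, so
they can serve as `R`. -/
theorem measure_biInter_completeBeforeUpTo [IsProbabilityMeasure P] [IsProbabilityMeasure μ]
    [l.NeBot] (hT : MemorylessArrivals μ P T l) (hl : ∀ᶠ h in l, 0 < h) {K : ℕ+} (J : Finset ℕ+)
    (hJ : ∀ n ∈ J, n ≤ K) (hK : ∀ n ∈ J, 0 < μ.real (edgesBetween n K)) :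
    P.real (T ⁻¹' ⋂ n ∈ J, completeBeforeUpTo K n) = ∏ n ∈ J, truncatedFactor μ K n := by
  induction J using Finset.induction_on_min with
  | empty => simp
  | insert n J hn ih =>
    simp only [Finset.mem_insert, forall_eq_or_imp] at hJ hK
    rw [Finset.set_biInter_insert, Finset.prod_insert fun h => (hn n h).false,
      hT.measure_completeBeforeUpTo_inter hl hK.1, ih hJ.2 hK.2]
    refine .biInter _ fun k hk => (shiftInvariantOn_completeBeforeUpTo K k).mono fun e he => ?_
    rw [mem_edgesBetween]
    rcases Finset.mem_union.1 he with he | he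
    · rw [mem_edgesBetween] at he
      exact ⟨(hn k hk).trans he.1, he.2⟩
    · rw [mem_edgesWithMax] at he
      exact ⟨he ▸ hn k hk, he ▸ hJ.2 k hk⟩

theorem measurableSet_completeBefore (n : ℕ+) : MeasurableSet {t | CompleteBefore t n} := by
  have : {t | CompleteBefore t n} =
      ⋂ (e : Edge) (f : Edge) (_ : e.max = n) (_ : n < f.max), {t : Edge → ℝ≥0∞ | t e ≤ t f} := by
    ext t
    simp [CompleteBefore]
  rw [this]
  exact .iInter fun e => .iInter fun f => .iInter fun _ => .iInter fun _ =>
    measurableSet_le (measurable_pi_apply e) (measurable_pi_apply f)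

/-- The events that the level `n` is complete before any edge above it are independent and have the
probability `factor μ n`. -/
theorem measure_completeBefore [IsProbabilityMeasure P] [IsProbabilityMeasure μ]
    [l.NeBot] (hT : MemorylessArrivals μ P T l) (hl : ∀ᶠ h in l, 0 < h)
    (hΛ : ∀ n, 0 < tailMass μ n) (J : Finset ℕ+) :
    P.real {ω | ∀ n ∈ J, CompleteBefore (T ω) n} = ∏ n ∈ J, factor μ n := by
  -- As `K → ∞` the truncated events decrease to the full ones, and the truncated factors converge.
  have h1 : Tendsto (fun K => ∏ n ∈ J, truncatedFactor μ K n) atTop (𝓝 (∏ n ∈ J, factor μ n)) :=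
    tendsto_finsetProd _ fun n _ => tendsto_truncatedFactor μ (hΛ n)
  have hmeas : ∀ K, MeasurableSet (T ⁻¹' ⋂ n ∈ J, completeBeforeUpTo K n) := fun K =>
    hT.measurable (J.measurableSet_biInter fun n _ =>
      (shiftInvariantOn_completeBeforeUpTo K n).measurableSet)
  have hanti : Antitone fun K => T ⁻¹' ⋂ n ∈ J, completeBeforeUpTo K n := by
    intro K K' hK ω hω
    simp only [Set.mem_preimage, Set.mem_iInter] at hω ⊢
    intro n hn e he f hf
    rw [mem_edgesBetween] at hf
    exact hω n hn e he f (mem_edgesBetween.2 ⟨hf.1, hf.2.trans hK⟩)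
  have hI : ⋂ K, T ⁻¹' ⋂ n ∈ J, completeBeforeUpTo K n =
      {ω | ∀ n ∈ J, CompleteBefore (T ω) n} := by
    ext ω
    simp only [Set.mem_iInter, Set.mem_preimage]
    constructor
    · intro h n hn e f he hf
      exact h f.max n hn e (mem_edgesWithMax.2 he) f (mem_edgesBetween.2 ⟨hf, le_rfl⟩)
    · intro h K n hn e he f hf
      exact h n hn e f (mem_edgesWithMax.1 he) (mem_edgesBetween.1 hf).1
  have h2 : Tendsto (fun K => P.real (T ⁻¹' ⋂ n ∈ J, completeBeforeUpTo K n)) atTop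
      (𝓝 (P.real {ω | ∀ n ∈ J, CompleteBefore (T ω) n})) := by
    rw [← hI]
    exact (ENNReal.tendsto_toReal (measure_ne_top _ _)).comp
      (tendsto_measure_iInter_atTop (fun K => (hmeas K).nullMeasurableSet) hanti
        ⟨1, measure_ne_top _ _⟩)
  refine tendsto_nhds_unique (h2.congr' ?_) h1
  have hK : ∀ᶠ K in atTop, ∀ n ∈ J, n ≤ K ∧ 0 < μ.real (edgesBetween n K) := by
    rw [Filter.eventually_all_finset]
    exact fun n _ => (eventually_ge_atTop n).and
      ((tendsto_measureReal_edgesBetween μ n).eventually_const_lt (hΛ n))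
  filter_upwards [hK] with K hK
  exact hT.measure_biInter_completeBeforeUpTo hl J (fun n hn => (hK n hn).1) fun n hn => (hK n hn).2

end MemorylessArrivals

end

section

/-! ### A product formula for tail events -/

section Tail

variable {Ω : Type*} [MeasurableSpace Ω] {P : Measure Ω} [IsProbabilityMeasure P]
  {B : ℕ+ → Set Ω} {p : ℕ+ → ℝ}

theorem tendsto_prod_Ioc (hB : ∀ n, MeasurableSet (B n))
    (hp : ∀ J : Finset ℕ+, P.real {ω | ∀ n ∈ J, ω ∈ B n} = ∏ n ∈ J, p n) (m : ℕ+) :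
    Tendsto (fun M => ∏ n ∈ Finset.Ioc m M, p n) atTop (𝓝 (P.real {ω | ∀ n > m, ω ∈ B n})) := by
  have hmeas : ∀ M, MeasurableSet {ω | ∀ n ∈ Finset.Ioc m M, ω ∈ B n} := by
    intro M
    have : {ω | ∀ n ∈ Finset.Ioc m M, ω ∈ B n} = ⋂ n ∈ Finset.Ioc m M, B n := by
      ext ω
      simp
    rw [this]
    exact Finset.measurableSet_biInter _ fun n _ => hB n
  have hanti : Antitone fun M => {ω | ∀ n ∈ Finset.Ioc m M, ω ∈ B n} := fun M M' hM ω hω n hn =>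
    hω n (Finset.Ioc_subset_Ioc_right hM hn)
  have hI : ⋂ M, {ω | ∀ n ∈ Finset.Ioc m M, ω ∈ B n} = {ω | ∀ n > m, ω ∈ B n} := by
    ext ω
    simp only [Set.mem_iInter]
    exact ⟨fun h n hn => h n n (Finset.mem_Ioc.2 ⟨hn, le_rfl⟩),
      fun h M n hn => h n (Finset.mem_Ioc.1 hn).1⟩
  simp_rw [← hp]
  rw [← hI]
  exact (ENNReal.tendsto_toReal (measure_ne_top _ _)).comp
    (tendsto_measure_iInter_atTop (fun M => (hmeas M).nullMeasurableSet) hanti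
      ⟨1, measure_ne_top _ _⟩)

theorem tendsto_prod_Icc (hB : ∀ n, MeasurableSet (B n))
    (hp : ∀ J : Finset ℕ+, P.real {ω | ∀ n ∈ J, ω ∈ B n} = ∏ n ∈ J, p n) (m : ℕ+) :
    Tendsto (fun M => ∏ n ∈ Finset.Icc 1 M, p n) atTop
      (𝓝 ((∏ n ∈ Finset.Icc 1 m, p n) * P.real {ω | ∀ n > m, ω ∈ B n})) := by
  refine ((tendsto_prod_Ioc hB hp m).const_mul _).congr' ?_
  filter_upwards [eventually_ge_atTop m] with M hM
  have : Finset.Icc 1 M = Finset.Icc 1 m ∪ Finset.Ioc m M := by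
    ext n
    simp only [Finset.mem_union, Finset.mem_Icc, Finset.mem_Ioc, one_le, true_and]
    grind
  rw [this, Finset.prod_union]
  rw [Finset.disjoint_left]
  intro n hn hn'
  exact absurd (Finset.mem_Icc.1 hn).2 (not_le.2 (Finset.mem_Ioc.1 hn').1)

theorem ae_exists_forall_gt_mem (hB : ∀ n, MeasurableSet (B n))
    (hp : ∀ J : Finset ℕ+, P.real {ω | ∀ n ∈ J, ω ∈ B n} = ∏ n ∈ J, p n) {L : ℝ} (hL : 0 < L)
    (h : Tendsto (fun M => ∏ n ∈ Finset.Icc 1 M, p n) atTop (𝓝 L)) :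
    ∀ᵐ ω ∂P, ∃ m, ∀ n > m, ω ∈ B n := by
  have hmul : ∀ m, (∏ n ∈ Finset.Icc 1 m, p n) * P.real {ω | ∀ n > m, ω ∈ B n} = L := fun m =>
    tendsto_nhds_unique (tendsto_prod_Icc hB hp m) h
  -- By `hmul` the quotient is the probability that all levels above `m` are good.
  have hlim : Tendsto (fun m => L / ∏ n ∈ Finset.Icc 1 m, p n) atTop (𝓝 (L / L)) :=
    tendsto_const_nhds.div h hL.ne'
  rw [div_self hL.ne'] at hlim
  have hge : 1 ≤ P.real {ω | ∃ m, ∀ n > m, ω ∈ B n} := by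
    refine le_of_tendsto' hlim fun m => ?_
    have hne : ∏ n ∈ Finset.Icc 1 m, p n ≠ 0 := fun h0 => hL.ne (by rw [← hmul m, h0, zero_mul])
    rw [← hmul m, mul_div_cancel_left₀ _ hne]
    exact measureReal_mono fun ω hω => ⟨m, hω⟩
  have hmeas : MeasurableSet {ω | ∃ m, ∀ n > m, ω ∈ B n} := by
    have : {ω | ∃ m, ∀ n > m, ω ∈ B n} = ⋃ m, ⋂ (n) (_ : n > m), B n := by
      ext ω
      simp
    rw [this]
    exact .iUnion fun m => .iInter fun n => .iInter fun _ => hB n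
  have hone : P {ω | ∃ m, ∀ n > m, ω ∈ B n} = 1 := by
    rw [← ENNReal.toReal_eq_one_iff]
    exact le_antisymm measureReal_le_one hge
  exact (prob_compl_eq_zero_iff hmeas).2 hone

theorem ae_not_exists_forall_gt_mem (hB : ∀ n, MeasurableSet (B n))
    (hp : ∀ J : Finset ℕ+, P.real {ω | ∀ n ∈ J, ω ∈ B n} = ∏ n ∈ J, p n) (hpos : ∀ n, 0 < p n)
    (h : Tendsto (fun M => ∏ n ∈ Finset.Icc 1 M, p n) atTop (𝓝 0)) :
    ∀ᵐ ω ∂P, ¬ ∃ m, ∀ n > m, ω ∈ B n := by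
  have hzero : ∀ m, ∀ᵐ ω ∂P, ¬ ∀ n > m, ω ∈ B n := by
    intro m
    have h0 := tendsto_nhds_unique (tendsto_prod_Icc hB hp m) h
    have := (mul_eq_zero.1 h0).resolve_left (Finset.prod_pos fun n _ => hpos n).ne'
    rw [ae_iff]
    simpa [measureReal_eq_zero_iff] using this
  filter_upwards [ae_all_iff.2 hzero] with ω hω
  push Not at hω ⊢
  exact hω

end Tail

/-! ### The dichotomy for memoryless arrivals -/

theorem tailMass_pos (μ : Measure Edge) [IsProbabilityMeasure μ]
    (hμ : ¬ BddAbove (supportVerts μ)) (n : ℕ+) : 0 < tailMass μ n := by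
  obtain ⟨v, ⟨e, hv, he⟩, hn⟩ := not_bddAbove_iff.1 hμ n
  rw [tailMass_eq]
  refine (ENNReal.toReal_pos he.ne' (measure_ne_top _ _)).trans_le ?_
  exact measureReal_mono (Set.singleton_subset_iff.2 (hn.trans_le (Edge.le_max hv)))

variable {Ω : Type*} [MeasurableSpace Ω] {P : Measure Ω} [IsProbabilityMeasure P]
  {μ : Measure Edge} [IsProbabilityMeasure μ] {T : Ω → Edge → ℝ≥0∞} {l : Filter ℝ}

namespace MemorylessArrivals

/-- The event `T e = ∞` is shift invariant and implies no arrival up to `h`, so its probability `x`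
satisfies `x = P(no arrival up to h) * x`. A positive rate gives some `h` with `P(no arrival up to
h) < 1`. -/
theorem ae_ne_top [l.NeBot] (hT : MemorylessArrivals μ P T l) {e : Edge} (he : 0 < μ {e}) :
    ∀ᵐ ω ∂P, T ω e ≠ ∞ := by
  have hpos : 0 < μ.real (({e} : Finset Edge) : Set Edge) := by
    rw [Finset.coe_singleton]
    exact ENNReal.toReal_pos he.ne' (measure_ne_top _ _)
  obtain ⟨h, hh, hlt⟩ := (hT.memoryless.and ((hT.rate {e}).eventually_const_lt hpos)).exists
  have hm := measurableSet_noneUpTo hT.measurable {e} h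
  have h1 := hh {e} _ (shiftInvariantOn_eq_top (Finset.mem_singleton_self e))
  have hsub : T ⁻¹' {t | t e = ∞} ⊆ noneUpTo T {e} h := by
    intro ω hω f hf
    rw [Finset.mem_singleton.1 hf, show T ω e = ∞ from hω]
    exact ENNReal.ofReal_lt_top
  rw [Set.inter_eq_right.2 hsub] at h1
  rw [probReal_compl_eq_one_sub hm] at hlt
  have hne : 1 - P.real (noneUpTo T {e} h) ≠ 0 := fun h0 => by simp [h0] at hlt
  have : P.real (T ⁻¹' {t | t e = ∞}) = 0 := by
    have : (1 - P.real (noneUpTo T {e} h)) * P.real (T ⁻¹' {t | t e = ∞}) = 0 := by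
      linarith
    exact (mul_eq_zero.1 this).resolve_left hne
  rw [ae_iff]
  simpa [measureReal_eq_zero_iff] using this

omit [IsProbabilityMeasure P] [IsProbabilityMeasure μ] in
theorem ae_eq_top (hT : MemorylessArrivals μ P T l) {e : Edge} (he : μ {e} = 0) :
    ∀ᵐ ω ∂P, T ω e = ∞ := by
  have : ∀ k : ℕ, ∀ᵐ ω ∂P, ¬ T ω e ≤ k := by
    intro k
    rw [ae_iff]
    simpa [he] using hT.measure_le e k
  filter_upwards [ae_all_iff.2 this] with ω hω
  by_contra hne
  obtain ⟨k, hk⟩ := ENNReal.exists_nat_gt hne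
  exact hω k hk.le

omit [IsProbabilityMeasure P] in
-- Borel-Cantelli: the probabilities of arrival up to `k` sum to at most `k`.
theorem ae_finite_le (hT : MemorylessArrivals μ P T l) :
    ∀ᵐ ω ∂P, ∀ k : ℕ, {e | T ω e ≤ k}.Finite := by
  rw [ae_all_iff]
  intro k
  refine ae_finite_setOfPred_mem (s := fun e => {ω | T ω e ≤ k}) (ne_top_of_le_ne_top ?_
    (ENNReal.tsum_le_tsum fun e => hT.measure_le e k))
  have h1 : ∑' e : Edge, μ {e} = μ Set.univ := by
    simpa using Measure.tsum_indicator_apply_singleton μ Set.univ .univ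
  rw [ENNReal.tsum_mul_left, h1, measure_univ, mul_one]
  exact ENNReal.natCast_ne_top k

/-- The dichotomy for the graph process with the arrival times `T`, where `ι` embeds the index set
into the time axis. -/
theorem ae_dichotomy [l.NeBot] (hT : MemorylessArrivals μ P T l) (hl : ∀ᶠ h in l, 0 < h)
    (hμ : ¬ BddAbove (supportVerts μ)) {I : Type*} [LinearOrder I] [Nonempty I] [NoMaxOrder I]
    {ι : I → ℝ≥0∞} (hι : StrictMono ι) (hιbdd : ∀ i, ∃ k : ℕ, ι i ≤ k)
    (hιT : ∀ᵐ ω ∂P, ∀ e, T ω e ≠ ∞ → ∃ i, T ω e = ι i) {Γ : Ω → I → Graph}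
    (hΓ : ∀ᵐ ω ∂P, ∀ i, Γ ω i = graphOfEdges {e | T ω e ≤ ι i}) :
    ∃ L : ℝ, Tendsto (fun M : ℕ+ => ∏ n ∈ Finset.Icc 1 M, factor μ n) atTop (𝓝 L) ∧
      (0 < L → ∀ᵐ ω ∂P, EventuallyForever EssentiallyComplete (Γ ω)) ∧
      (¬ 0 < L → ∀ᵐ ω ∂P, ¬ EventuallyForever EssentiallyComplete (Γ ω)) := by
  have hΛ := tailMass_pos μ hμ
  have hp := hT.measure_completeBefore hl hΛ
  have hB : ∀ n, MeasurableSet {ω | CompleteBefore (T ω) n} := fun n =>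
    hT.measurable (measurableSet_completeBefore n)
  have hlim := tendsto_prod_Icc hB hp 1
  set L := (∏ n ∈ Finset.Icc 1 1, factor μ n) *
    P.real {ω | ∀ n > 1, ω ∈ {ω | CompleteBefore (T ω) n}} with hLdef
  have hL0 : 0 ≤ L := ge_of_tendsto' hlim fun M => by
    rw [← hp]
    exact measureReal_nonneg
  have hΓ' : ∀ᵐ ω ∂P, Γ ω = fun i => graphOfEdges {e | T ω e ≤ ι i} := by
    filter_upwards [hΓ] with ω hω using funext hω
  have hfin : ∀ᵐ ω ∂P, ∀ i, {e | T ω e ≤ ι i}.Finite := by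
    filter_upwards [hT.ae_finite_le] with ω hω i
    obtain ⟨k, hk⟩ := hιbdd i
    exact (hω k).subset fun e he => le_trans he hk
  have hall : (∀ e, 0 < μ {e}) → ∀ᵐ ω ∂P, ∀ e, ∃ i, T ω e = ι i := by
    intro h
    filter_upwards [hιT, ae_all_iff.2 fun e => hT.ae_ne_top (h e)] with ω hω hω' e
    exact hω e (hω' e)
  have hreal : ∀ {e}, μ {e} = 0 → μ.real {e} = 0 := fun he => by simp [measureReal_def, he]
  refine ⟨L, hlim, fun hL => ?_, fun hL => ?_⟩
  · have hpos : ∀ e, 0 < μ {e} := by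
      intro e
      rw [pos_iff_ne_zero]
      intro he
      have hz := factor_eq_zero μ (hreal he)
      refine hL.ne (tendsto_nhds_unique (tendsto_const_nhds.congr' ?_) hlim)
      filter_upwards [eventually_ge_atTop e.max] with M hM
      exact (Finset.prod_eq_zero (Finset.mem_Icc.2 ⟨one_le, hM⟩) hz).symm
    filter_upwards [hΓ', hfin, hall hpos, ae_exists_forall_gt_mem hB hp hL hlim]
      with ω h1 h2 h3 ⟨m, hm⟩
    rw [h1]
    exact eventuallyForever_of_completeBefore hι h3 h2 (m := m + 1) fun n hn =>
      hm n ((PNat.lt_add_right m 1).trans_le hn)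
  · have hL' : L = 0 := le_antisymm (not_lt.1 hL) hL0
    by_cases hpos : ∀ e, 0 < μ {e}
    · have hf : ∀ n, 0 < factor μ n := fun n => factor_pos μ n (hΛ n) fun e =>
        ENNReal.toReal_pos (hpos e).ne' (measure_ne_top _ _)
      rw [hL'] at hlim
      filter_upwards [hΓ', hfin, hall hpos, ae_not_exists_forall_gt_mem hB hp hf hlim]
        with ω h1 h2 h3 h4 h5
      rw [h1] at h5
      obtain ⟨m, hm⟩ := completeBefore_of_eventuallyForever hι h3 h2 h5
      exact h4 ⟨m, fun n hn => hm n hn.le⟩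
    -- An edge `e` of mass zero never comes, whereas some higher edge `f` has positive mass and does
    -- come.
    · push Not at hpos
      obtain ⟨e, he⟩ := hpos
      obtain ⟨v, ⟨f, hv, hf⟩, hn⟩ := not_bddAbove_iff.1 hμ e.max
      filter_upwards [hΓ', hιT, hT.ae_ne_top hf, hT.ae_eq_top (nonpos_iff_eq_zero.1 he)]
        with ω h1 h2 h3 h4
      rw [h1]
      exact not_eventuallyForever_of_eq_top hι h2 h4 ⟨f, hn.trans_le (Edge.le_max hv), h3⟩

end MemorylessArrivals

end

section

/-! ### Discrete time -/

/-- The first time an edge occurs in the sequence `x`, the entries of which are counted from `1`. -/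
noncomputable def arrival (x : ℕ → Edge) (e : Edge) : ℝ≥0∞ :=
  ⨅ n : ℕ, if x n = e then (n : ℝ≥0∞) + 1 else ∞

/-- The entry `x j` is drawn at time `j + 1`, whence the strict inequality `j < k`. -/
theorem arrival_le_iff {x : ℕ → Edge} {e : Edge} {k : ℕ} :
    arrival x e ≤ k ↔ ∃ j < k, x j = e := by
  constructor
  · intro h
    by_contra! hne
    have : (k : ℝ≥0∞) + 1 ≤ arrival x e := by
      refine le_iInf fun n => ?_
      split_ifs with hn
      · gcongr
        exact_mod_cast not_lt.1 fun hlt => hne n hlt hn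
      · exact le_top
    have h' : ((k + 1 : ℕ) : ℝ≥0∞) ≤ (k : ℕ) := by
      push_cast
      exact this.trans h
    exact absurd (Nat.cast_le.1 h') (by simp)
  · rintro ⟨j, hj, he⟩
    refine (iInf_le _ j).trans ?_
    rw [if_pos he]
    exact_mod_cast hj

theorem arrival_eq_natCast {x : ℕ → Edge} {e : Edge} (h : arrival x e ≠ ∞) :
    ∃ k : ℕ, arrival x e = k := by
  have hex : ∃ n, x n = e := by
    by_contra! hne
    exact h (by simp [arrival, hne])
  classical
  refine ⟨Nat.find hex + 1, le_antisymm ?_ ?_⟩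
  · exact arrival_le_iff.2 ⟨_, Nat.lt_succ_self _, Nat.find_spec hex⟩
  · refine le_iInf fun n => ?_
    split_ifs with hn
    · exact_mod_cast Nat.succ_le_succ (Nat.find_min' hex hn)
    · exact le_top

theorem one_lt_arrival_iff {x : ℕ → Edge} {e : Edge} : 1 < arrival x e ↔ x 0 ≠ e := by
  rw [← not_le, ← Nat.cast_one, arrival_le_iff]
  simp

theorem arrival_succ {x : ℕ → Edge} {e : Edge} (h : x 0 ≠ e) :
    arrival (fun n => x (n + 1)) e = arrival x e - 1 := by
  have : arrival x e = arrival (fun n => x (n + 1)) e + 1 := by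
    rw [arrival, arrival, ENNReal.iInf_add, ← inf_iInf_nat_succ]
    simp only [h, if_false, top_inf_eq]
    refine iInf_congr fun n => ?_
    split_ifs <;> simp
  rw [this, ENNReal.add_sub_cancel_right ENNReal.one_ne_top]

theorem measurable_arrival : Measurable arrival := by
  refine measurable_pi_lambda _ fun e => .iInf fun n => ?_
  have h : MeasurableSet ((fun x : ℕ → Edge => x n) ⁻¹' {e}) := measurable_pi_apply n trivial
  exact Measurable.ite h measurable_const measurable_const

theorem discreteGraph_eq_arrival (x : ℕ → Edge) (n : ℕ) :
    discreteGraph x n = graphOfEdges {e | arrival x e ≤ n} := by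
  simp_rw [discreteGraph_eq, arrival_le_iff]

variable {Ω : Type*} [MeasurableSpace Ω] {P : Measure Ω} [IsProbabilityMeasure P]
  {μ : Measure Edge} [IsProbabilityMeasure μ] {X : ℕ → Ω → Edge}

omit [IsProbabilityMeasure P] in
theorem indepFun_zero_succ {α : Type*} [MeasurableSpace α] {X : ℕ → Ω → α}
    (hX : ∀ n, Measurable (X n)) (hindep : iIndepFun X P) :
    IndepFun (X 0) (fun ω n => X (n + 1) ω) P := by
  have hdisj : Disjoint ({0} : Set ℕ) (Set.Ici 1) := by simp
  have h := indep_iSup_of_disjoint (fun n => (hX n).comap_le) hindep hdisj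
  refine indep_of_indep_of_le_left (indep_of_indep_of_le_right h ?_) ?_
  · rw [MeasurableSpace.pi, MeasurableSpace.comap_iSup]
    refine iSup_le fun n => ?_
    rw [MeasurableSpace.comap_comp]
    exact le_iSup₂_of_le (n + 1) (by simp) le_rfl
  · exact le_iSup₂_of_le 0 rfl le_rfl

omit [IsProbabilityMeasure μ] in
theorem map_succ_eq (hX : ∀ n, Measurable (X n)) (hlaw : ∀ n, P.map (X n) = μ)
    (hindep : iIndepFun X P) :
    P.map (fun ω n => X (n + 1) ω) = P.map (fun ω n => X n ω) := by
  rw [(iIndepFun_iff_map_fun_eq_infinitePi_map hX).1 hindep,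
    (iIndepFun_iff_map_fun_eq_infinitePi_map fun n => hX (n + 1)).1
      (hindep.precomp (g := fun n => n + 1) (add_left_injective 1))]
  simp_rw [hlaw]

omit [IsProbabilityMeasure μ] in
-- If the first draw misses `W`, the arrival times on `W` minus `1` are those of the shifted
-- sequence, which is independent of the first draw and has the law of the original one. The rate is
-- exact at `h = 1`, since the first draw lies in `W` with probability `μ(W)`.
theorem memorylessArrivals_arrival (hX : ∀ n, Measurable (X n)) (hlaw : ∀ n, P.map (X n) = μ)
    (hindep : iIndepFun X P) :
    MemorylessArrivals μ P (fun ω => arrival fun n => X n ω) (pure 1) := by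
  have hlaw' : ∀ n (s : Set Edge), P (X n ⁻¹' s) = μ s := fun n s => by
    rw [← hlaw n, Measure.map_apply (hX n) .of_discrete]
  have hnone : ∀ W : Finset Edge,
      noneUpTo (fun ω => arrival fun n => X n ω) W 1 = X 0 ⁻¹' (W : Set Edge)ᶜ := by
    intro W
    ext ω
    simp only [noneUpTo, ENNReal.ofReal_one, one_lt_arrival_iff, Set.mem_preimage,
      Set.mem_compl_iff, Finset.mem_coe]
    exact ⟨fun h hW => h _ hW rfl, fun h e he h0 => h (h0 ▸ he)⟩
  have hXm : Measurable fun ω n => X n ω := measurable_pi_lambda _ hX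
  have hXm' : Measurable fun ω n => X (n + 1) ω := measurable_pi_lambda _ fun n => hX (n + 1)
  refine ⟨measurable_arrival.comp hXm, fun e k => ?_, ?_, fun W => ?_⟩
  · have : {ω | arrival (fun n => X n ω) e ≤ k} ⊆ ⋃ j ∈ Finset.range k, X j ⁻¹' {e} := by
      intro ω hω
      obtain ⟨j, hj, he⟩ := arrival_le_iff.1 hω
      exact Set.mem_biUnion (Finset.mem_coe.2 (Finset.mem_range.2 hj)) he
    refine (measure_mono this).trans ((measure_biUnion_finset_le _ _).trans ?_)
    simp [hlaw']
  · refine eventually_pure.2 fun W G hG => ?_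
    rw [hnone]
    have hset : X 0 ⁻¹' (W : Set Edge)ᶜ ∩ (fun ω => arrival fun n => X n ω) ⁻¹' G =
        X 0 ⁻¹' (W : Set Edge)ᶜ ∩ (fun ω n => X (n + 1) ω) ⁻¹' (arrival ⁻¹' G) := by
      ext ω
      refine and_congr_right fun hω => ?_
      have h0 : ∀ e ∈ W, X 0 ω ≠ e := fun e he h0 => hω (h0 ▸ he)
      have h1 : ∀ e ∈ W, arrival (fun n => X (n + 1) ω) e = arrival (fun n => X n ω) e - 1 :=
        fun e he => arrival_succ (x := fun n => X n ω) (h0 e he)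
      refine (hG.shift 1 _ fun e he => one_lt_arrival_iff.2 (h0 e he)).trans ?_
      exact ⟨hG.congr _ _ fun e he => (h1 e he).symm, hG.congr _ _ h1⟩
    rw [hset, measureReal_def, (indepFun_zero_succ hX hindep).measure_inter_preimage_eq_mul _ _
      .of_discrete (measurable_arrival hG.measurableSet), ENNReal.toReal_mul]
    congr 1
    have hm := measurable_arrival hG.measurableSet
    rw [← Measure.map_apply hXm' hm, map_succ_eq hX hlaw hindep, Measure.map_apply hXm hm]
    rfl
  · rw [tendsto_pure_left]
    intro s hs
    rw [hnone, ← Set.preimage_compl, compl_compl, measureReal_def, hlaw', div_one]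
    exact mem_of_mem_nhds hs

end

section

/-! ### Continuous time -/

/-- The first time at which the path `c` is positive. -/
noncomputable def firstJump (c : ℝ≥0 → ℕ) : ℝ≥0∞ :=
  ⨅ q : ℚ, if 0 < c (Real.toNNReal q) then (Real.toNNReal q : ℝ≥0∞) else ∞

/-- The infimum in `firstJump` is over rational times to keep it countable. -/
theorem measurable_firstJump : Measurable firstJump := by
  refine .iInf fun q => ?_
  exact Measurable.ite (measurableSet_lt measurable_const (measurable_pi_apply _)) measurable_const
    measurable_const

/-- If `c t = 0`, right continuity of the integer-valued path keeps it `0` up to some `u > t`, so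
the first jump is not before `u`. Conversely, a path positive at `t` is positive at the rationals
just after `t`. -/
theorem firstJump_le_iff {c : ℝ≥0 → ℕ} (hmono : Monotone c)
    (hcts : ∀ t, ContinuousWithinAt c (Set.Ici t) t) (t : ℝ≥0) :
    firstJump c ≤ t ↔ 0 < c t := by
  constructor
  · intro h
    by_contra hc
    have h0 : Tendsto c (𝓝[>] t) (𝓝 (c t)) := (hcts t).mono Set.Ioi_subset_Ici_self
    rw [nhds_discrete, tendsto_pure] at h0
    obtain ⟨u, hu, htu⟩ := (h0.and self_mem_nhdsWithin).exists
    have : (u : ℝ≥0∞) ≤ firstJump c := by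
      refine le_iInf fun q => ?_
      split_ifs with hq
      · rw [ENNReal.coe_le_coe]
        by_contra! hlt
        have := hmono hlt.le
        omega
      · exact le_top
    exact absurd (ENNReal.coe_le_coe.1 (this.trans h)) (not_le.2 htu)
  · intro hc
    refine le_of_forall_gt fun s hs => ?_
    obtain ⟨q, -, h1, h2⟩ := ENNReal.lt_iff_exists_rat_btwn.1 hs
    refine (iInf_le _ q).trans_lt ?_
    rw [if_pos (hc.trans_le (hmono (ENNReal.coe_lt_coe.1 h1).le))]
    exact h2

theorem IsPoissonProcess.measure_lt_firstJump {Ω : Type*} [MeasurableSpace Ω] {P : Measure Ω}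
    {N : ℝ≥0 → Ω → ℕ} {r : ℝ≥0} (hN : IsPoissonProcess N r P) (t : ℝ≥0) :
    P {ω | t < firstJump fun s => N s ω} = ENNReal.ofReal (Real.exp (-(r * t))) := by
  have h1 : P {ω | t < firstJump fun s => N s ω} = P {ω | N t ω - N 0 ω = 0} := by
    refine measure_congr ?_
    filter_upwards [hN.zero, hN.monotone, hN.rightCts] with ω h0 hm hc
    refine propext ?_
    change _ < _ ↔ _ - _ = 0
    rw [← not_le, firstJump_le_iff hm hc, h0]
    omega
  rw [h1, (hN.law 0 t zero_le).measure_eq (p := fun k => k = 0) .of_discrete]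
  simp [poissonMeasure_singleton]

/-- The exponential distribution has no memory. -/
theorem map_restrict_sub_eq {ν : Measure ℝ≥0∞} [IsProbabilityMeasure ν] {r : ℝ≥0}
    (hν : ∀ t : ℝ≥0, ν (Set.Ioi t) = ENNReal.ofReal (Real.exp (-(r * t)))) (h : ℝ≥0) :
    (ν.restrict (Set.Ioi (h : ℝ≥0∞))).map (fun x : ℝ≥0∞ => x - h) = ν (Set.Ioi (h : ℝ≥0∞)) • ν := by
  have hm : Measurable fun x : ℝ≥0∞ => x - h := measurable_id.sub_const _
  refine ext_of_generate_finite (Set.range Set.Ioi) ?_ isPiSystem_Ioi ?_ ?_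
  · rw [BorelSpace.measurable_eq (α := ℝ≥0∞), borel_eq_generateFrom_Ioi]
  · rintro _ ⟨a, rfl⟩
    rw [Measure.map_apply hm measurableSet_Ioi, Measure.restrict_apply (hm measurableSet_Ioi)]
    have hset : (fun x : ℝ≥0∞ => x - h) ⁻¹' Set.Ioi a ∩ Set.Ioi (h : ℝ≥0∞) = Set.Ioi (a + h) := by
      ext x
      simp only [Set.mem_inter_iff, Set.mem_preimage, Set.mem_Ioi, lt_tsub_iff_right]
      exact ⟨fun hx => hx.1, fun hx => ⟨hx, le_add_self.trans_lt hx⟩⟩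
    rw [hset]
    rcases eq_or_ne a ∞ with rfl | ha
    · simp
    · lift a to ℝ≥0 using ha
      rw [← ENNReal.coe_add, hν, Measure.smul_apply, hν, hν, smul_eq_mul,
        ← ENNReal.ofReal_mul (Real.exp_nonneg _), ← Real.exp_add]
      push_cast
      congr 2
      ring
  · rw [Measure.map_apply hm .univ]
    simp

section

variable {Ω : Type*} [MeasurableSpace Ω] {P : Measure Ω} [IsProbabilityMeasure P]
  {μ : Measure Edge} [IsProbabilityMeasure μ] {T : Ω → Edge → ℝ≥0∞}

omit [IsProbabilityMeasure P] in
theorem measure_noneUpTo (hindep : iIndepFun (fun e ω => T ω e) P) (W : Finset Edge) (h : ℝ) :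
    P (noneUpTo T W h) = ∏ e ∈ W, P {ω | ENNReal.ofReal h < T ω e} := by
  have : noneUpTo T W h = ⋂ e ∈ W, (fun ω => T ω e) ⁻¹' Set.Ioi (ENNReal.ofReal h) := by
    ext ω
    simp [noneUpTo]
  rw [this, hindep.measure_inter_preimage_eq_mul W fun _ _ => measurableSet_Ioi]
  rfl

/-- The times on `W` have a product law. On the box where all of them exceed `h`, subtracting `h`
restores each marginal up to a constant, so it restores the product law up to the mass of the box.
-/
theorem memorylessAt_of_iIndepFun (hT : ∀ e, Measurable fun ω => T ω e)
    (hindep : iIndepFun (fun e ω => T ω e) P) {r : Edge → ℝ≥0}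
    (hexp : ∀ e (t : ℝ≥0), P {ω | t < T ω e} = ENNReal.ofReal (Real.exp (-(r e * t)))) (h : ℝ) :
    MemorylessAt P T h := by
  intro W G hG
  set a : ℝ≥0 := h.toNNReal with ha
  let F : Ω → W → ℝ≥0∞ := fun ω e => T ω e
  -- The value `0` outside `W` is arbitrary, because `G` depends only on the times in `W`.
  let E : (W → ℝ≥0∞) → Edge → ℝ≥0∞ := fun w e => if he : e ∈ W then w ⟨e, he⟩ else 0
  let ν : W → Measure ℝ≥0∞ := fun e => P.map fun ω => T ω e
  have hν : ∀ e, IsProbabilityMeasure (ν e) := fun e => Measure.isProbabilityMeasure_map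
    (hT e).aemeasurable
  have hFm : Measurable F := measurable_pi_lambda _ fun e => hT e
  have hEm : Measurable E := by
    refine measurable_pi_lambda _ fun e => ?_
    by_cases he : e ∈ W
    · simpa [E, he] using measurable_pi_apply (⟨e, he⟩ : W)
    · simp [E, he]
  have hEapp : ∀ (w : W → ℝ≥0∞) (e : Edge) (he : e ∈ W), E w e = w ⟨e, he⟩ := fun w e he => by
    simp [E, he]
  have hG' : MeasurableSet (E ⁻¹' G) := hEm hG.measurableSet
  let box : Set (W → ℝ≥0∞) := Set.univ.pi fun _ => Set.Ioi (a : ℝ≥0∞)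
  have hbox : MeasurableSet box := .univ_pi fun _ => measurableSet_Ioi
  have hlaw : P.map F = Measure.pi ν :=
    (iIndepFun_iff_map_fun_eq_pi_map fun e : W => (hT e).aemeasurable).1
      (hindep.precomp Subtype.val_injective)
  have hnone : noneUpTo T W h = F ⁻¹' box := by
    ext ω
    simp only [noneUpTo, box, F, Set.mem_preimage, Set.mem_univ_pi, Set.mem_Ioi, Subtype.forall]
    rfl
  have hTG : T ⁻¹' G = F ⁻¹' (E ⁻¹' G) := by
    ext ω
    have : ∀ e ∈ W, T ω e = E (F ω) e := fun e he => by rw [hEapp _ e he]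
    exact ⟨hG.congr _ _ this, hG.congr _ _ fun e he => (this e he).symm⟩
  let σ : (W → ℝ≥0∞) → W → ℝ≥0∞ := fun w e => w e - a
  have hσ : Measurable σ := measurable_pi_lambda _ fun e => (measurable_pi_apply e).sub_const _
  have hshift : box ∩ E ⁻¹' G = σ ⁻¹' (E ⁻¹' G) ∩ box := by
    rw [Set.inter_comm]
    ext w
    refine and_congr_left fun hw => ?_
    refine (hG.shift a (E w) fun e he => ?_).trans ?_
    · rw [hEapp w e he]
      exact hw ⟨e, he⟩ trivial
    · have : ∀ e ∈ W, E w e - a = E (σ w) e := fun e he => by rw [hEapp _ e he, hEapp _ e he]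
      exact ⟨hG.congr _ _ this, hG.congr _ _ fun e he => (this e he).symm⟩
  have hνa : ∀ e, ((ν e).restrict (Set.Ioi (a : ℝ≥0∞))).map (fun x : ℝ≥0∞ => x - a) =
      ν e (Set.Ioi (a : ℝ≥0∞)) • ν e := fun e =>
    map_restrict_sub_eq (r := r e) (fun t => by
      rw [Measure.map_apply (hT e) measurableSet_Ioi]
      exact hexp e t) a
  have hpi : ((Measure.pi ν).restrict box).map σ = (Measure.pi ν box) • Measure.pi ν := by
    rw [Measure.restrict_pi_pi, Measure.pi_map_pi (f := fun _ x => x - (a : ℝ≥0∞))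
      fun e => (measurable_id.sub_const _).aemeasurable]
    refine Measure.pi_eq fun s _ => ?_
    rw [Measure.smul_apply, Measure.pi_pi, Measure.pi_pi, smul_eq_mul, ← Finset.prod_mul_distrib]
    refine Finset.prod_congr rfl fun e _ => ?_
    rw [hνa, Measure.smul_apply, smul_eq_mul]
  have hfinal : Measure.pi ν (box ∩ E ⁻¹' G) = Measure.pi ν box * Measure.pi ν (E ⁻¹' G) := by
    rw [hshift, ← Measure.restrict_apply (hσ hG'), ← Measure.map_apply hσ hG', hpi]
    rfl
  rw [hnone, hTG, ← Set.preimage_inter, measureReal_def, measureReal_def, measureReal_def,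
    ← Measure.map_apply hFm (hbox.inter hG'), ← Measure.map_apply hFm hbox,
    ← Measure.map_apply hFm hG', hlaw, hfinal, ENNReal.toReal_mul]

/-- The bound on early arrivals is `1 - exp(-x) ≤ x`, and the rate is the derivative of `1 -
exp(-μ(W) h)` at `h = 0`. -/
theorem memorylessArrivals_of_iIndepFun (hT : ∀ e, Measurable fun ω => T ω e)
    (hindep : iIndepFun (fun e ω => T ω e) P)
    (hexp : ∀ e (t : ℝ≥0), P {ω | t < T ω e} = ENNReal.ofReal (Real.exp (-(μ.real {e} * t)))) :
    MemorylessArrivals μ P T (𝓝[>] 0) := by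
  have hTm : Measurable T := measurable_pi_lambda _ hT
  refine ⟨hTm, fun e k => ?_, .of_forall fun h => ?_, fun W => ?_⟩
  · have hset : {ω | T ω e ≤ k} = {ω | ((k : ℝ≥0) : ℝ≥0∞) < T ω e}ᶜ := by
      ext ω
      simp
    rw [hset, prob_compl_eq_one_sub (measurableSet_lt measurable_const (hT e)), hexp,
      ← ENNReal.ofReal_one, ← ENNReal.ofReal_sub _ (Real.exp_nonneg _)]
    have hle := Real.one_sub_le_exp_neg (μ.real {e} * (k : ℝ≥0))
    refine (ENNReal.ofReal_le_ofReal (q := μ.real {e} * k) ?_).trans ?_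
    · push_cast at hle ⊢
      linarith
    · rw [ENNReal.ofReal_mul measureReal_nonneg, measureReal_def,
        ENNReal.ofReal_toReal (measure_ne_top _ _), ENNReal.ofReal_natCast, mul_comm]
  · exact memorylessAt_of_iIndepFun hT hindep (r := fun e => (μ.real {e}).toNNReal)
      (fun e t => by rw [hexp, Real.coe_toNNReal _ measureReal_nonneg]) h
  · have hval : ∀ h : ℝ, 0 < h →
        P.real (noneUpTo T W h)ᶜ = 1 - Real.exp (-(μ.real W * h)) := by
      intro h hh
      rw [probReal_compl_eq_one_sub (MemorylessArrivals.measurableSet_noneUpTo hTm W h),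
        measureReal_def, measure_noneUpTo hindep, ENNReal.toReal_prod,
        ← sum_measureReal_singleton, Finset.sum_mul, ← Finset.sum_neg_distrib, Real.exp_sum]
      congr 1
      refine Finset.prod_congr rfl fun e _ => ?_
      have := hexp e h.toNNReal
      rw [Real.coe_toNNReal h hh.le] at this
      exact (congrArg ENNReal.toReal this).trans (ENNReal.toReal_ofReal (Real.exp_nonneg _))
    have hderiv : HasDerivAt (fun h : ℝ => 1 - Real.exp (-(μ.real W * h))) (μ.real W) 0 := by
      have h1 : HasDerivAt (fun h : ℝ => -(μ.real W * h)) (-(μ.real W * 1)) 0 :=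
        ((hasDerivAt_id 0).const_mul _).neg
      simpa using h1.exp.const_sub 1
    refine hderiv.tendsto_slope_zero_right.congr' ?_
    filter_upwards [self_mem_nhdsWithin] with h hh
    rw [hval h hh]
    simp [div_eq_inv_mul]

end

end

/-! ### The dichotomy for the two graph processes -/

section

variable {Ω : Type*} [MeasurableSpace Ω] {P : Measure Ω} [IsProbabilityMeasure P]
  {μ : Measure Edge} [IsProbabilityMeasure μ]

theorem discreteGraph_dichotomy (hμ : ¬ BddAbove (supportVerts μ)) {X : ℕ → Ω → Edge}
    (hXlaw : ∀ n, HasLaw (X n) μ P) (hXindep : iIndepFun X P) :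
    ∃ L : ℝ, Tendsto (fun M : ℕ+ => ∏ n ∈ Finset.Icc 1 M, factor μ n) atTop (𝓝 L) ∧
      (0 < L → ∀ᵐ ω ∂P, EventuallyForever EssentiallyComplete (discreteGraph fun n => X n ω)) ∧
      (¬ 0 < L →
        ∀ᵐ ω ∂P, ¬ EventuallyForever EssentiallyComplete (discreteGraph fun n => X n ω)) := by
  -- `HasLaw` gives only a.e. measurability, so the draws are replaced by measurable versions.
  let Y : ℕ → Ω → Edge := fun n => (hXlaw n).aemeasurable.mk (X n)
  have hY : ∀ n, Measurable (Y n) := fun n => (hXlaw n).aemeasurable.measurable_mk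
  have hXY : ∀ n, X n =ᵐ[P] Y n := fun n => (hXlaw n).aemeasurable.ae_eq_mk
  have hT := memorylessArrivals_arrival hY
    (fun n => by rw [← Measure.map_congr (hXY n), (hXlaw n).map_eq]) (hXindep.congr hXY)
  refine hT.ae_dichotomy (eventually_pure.2 one_pos) hμ (ι := fun n : ℕ => (n : ℝ≥0∞))
    Nat.strictMono_cast (fun i => ⟨i, le_rfl⟩) (.of_forall fun ω e => arrival_eq_natCast) ?_
  filter_upwards [ae_all_iff.2 hXY] with ω hω n
  simp_rw [hω, discreteGraph_eq_arrival]

theorem continuousGraph_dichotomy (hμ : ¬ BddAbove (supportVerts μ)) {N : Edge → ℝ≥0 → Ω → ℕ}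
    (hN : ∀ e, IsPoissonProcess (N e) (μ {e}).toNNReal P)
    (hNindep : iIndepFun (fun (e : Edge) (ω : Ω) (t : ℝ≥0) => N e t ω) P) :
    ∃ L : ℝ, Tendsto (fun M : ℕ+ => ∏ n ∈ Finset.Icc 1 M, factor μ n) atTop (𝓝 L) ∧
      (0 < L →
        ∀ᵐ ω ∂P, EventuallyForever EssentiallyComplete (continuousGraph fun e t => N e t ω)) ∧
      (¬ 0 < L →
        ∀ᵐ ω ∂P, ¬ EventuallyForever EssentiallyComplete (continuousGraph fun e t => N e t ω)) := by
  have hT := memorylessArrivals_of_iIndepFun (μ := μ)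
    (T := fun ω e => firstJump fun t => N e t ω)
    (fun e => measurable_firstJump.comp (measurable_pi_lambda _ (hN e).measurable))
    (hNindep.comp (fun _ => firstJump) fun _ => measurable_firstJump)
    (fun e t => (hN e).measure_lt_firstJump t)
  refine hT.ae_dichotomy self_mem_nhdsWithin hμ (ι := fun t : ℝ≥0 => (t : ℝ≥0∞))
    ENNReal.coe_strictMono (fun i => ?_)
    (.of_forall fun ω e he => ⟨_, (ENNReal.coe_toNNReal he).symm⟩) ?_
  · obtain ⟨k, hk⟩ := exists_nat_ge i
    exact ⟨k, by exact_mod_cast hk⟩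
  · filter_upwards [ae_all_iff.2 fun e => (hN e).monotone, ae_all_iff.2 fun e => (hN e).rightCts]
      with ω hm hc t
    simp_rw [firstJump_le_iff (hm _) (hc _)]
    rfl

end

end ENNRealNotation

end EdgeProcess

theorem proposition6p3
    (μ : Measure Edge) [IsProbabilityMeasure μ]
    -- the support of `μ` is unbounded
    (hμ : ¬ BddAbove (supportVerts μ))
    -- discrete time: i.i.d. edges with law `μ`
    {Ω : Type*} [MeasurableSpace Ω] (P : Measure Ω) [IsProbabilityMeasure P]
    (X : ℕ → Ω → Edge) (hXlaw : ∀ n, HasLaw (X n) μ P) (hXindep : iIndepFun X P)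
    -- continuous time: independent Poisson processes with intensities `μ_e`
    {Ω' : Type*} [MeasurableSpace Ω'] (P' : Measure Ω') [IsProbabilityMeasure P']
    (N : Edge → ℝ≥0 → Ω' → ℕ)
    (hN : ∀ e, IsPoissonProcess (N e) (μ {e}).toNNReal P')
    (hNindep : iIndepFun (fun (e : Edge) (ω : Ω') (t : ℝ≥0) => N e t ω) P') :
    ∃ L : ℝ,
      Tendsto (fun M : ℕ+ => ∏ n ∈ Finset.Icc 1 M, factor μ n) atTop (𝓝 L) ∧
      (0 < L →
        (∀ᵐ ω ∂P', EventuallyForever EssentiallyComplete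
          (continuousGraph fun e t => N e t ω)) ∧
        (∀ᵐ ω ∂P, EventuallyForever EssentiallyComplete (discreteGraph fun n => X n ω))) ∧
      (¬ 0 < L →
        (∀ᵐ ω ∂P', ¬ EventuallyForever EssentiallyComplete
          (continuousGraph fun e t => N e t ω)) ∧
        (∀ᵐ ω ∂P, ¬ EventuallyForever EssentiallyComplete (discreteGraph fun n => X n ω))) := by
  obtain ⟨L, hL, hpos, hzero⟩ := continuousGraph_dichotomy hμ hN hNindep
  obtain ⟨L', hL', hpos', hzero'⟩ := discreteGraph_dichotomy hμ hXlaw hXindep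
  -- Both limits are of the same product, which depends on `μ` alone.
  obtain rfl := tendsto_nhds_unique hL hL'
  exact ⟨L, hL, fun h => ⟨hpos h, hpos' h⟩, fun h => ⟨hzero h, hzero' h⟩⟩
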